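/- Let $(U_i)_{i\in\mathbb N}$ be i.i.d. uniform on $[0,1]$. For words $\phi\in\{0,1\}^*$ define recursively $[L_\epsilon,R_\epsilon):=[0,1)$, $\tau_\phi:=\inf\{i: L_\phi<U_i<R_\phi\}$, $L_{\phi0}:=L_\phi$, $R_{\phi1}:=R_\phi$, $L_{\phi1}:=R_{\phi0}:=U_{\tau_\phi}$, $I_\phi:=R_\phi-L_\phi$, and put $\mathcal F_\infty:=\sigma(I_\phi:\phi\in\{0,1\}^*)$. For $\alpha\in[0,1]$ let $\phi(\alpha,0):=\epsilon$ and $\phi(\alpha,k+1):=\phi(\alpha,k)0$ if $\alpha<U_{\tau_{\phi(\alpha,k)}}$, $\phi(\alpha,k+1):=\phi(\alpha,k)1$ otherwise; an index $\alpha,k$ abbreviates $\phi(\alpha,k)$. Let $S_\alpha:=\sum_{k\ge0}I_{\alpha,k}$ and $J=J(\alpha,\gamma):=\max\{k:\tau_{\alpha,k}=\tau_{\gamma,k}\}\in\mathbb N_0\cup\{\infty\}$. The limit processes are the following. (a) $G_\infty=(G_{\alpha,\infty})_{\alpha\in[0,1]}$ is any process with almost surely càdlàg paths which, conditionally on $\mathcal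 F_\infty$, is a centred Gaussian process with covariance function $$\Sigma_{\alpha,\gamma}=\sum_{k=0}^{J}\sum_{j=0}^\infty I_{\alpha,\max(j,k)}+\mathbf 1_{\{\alpha\ne\gamma\}}(J+1)\sum_{j=J+1}^\infty I_{\gamma,j}-S_\alpha S_\gamma .$$ (b) Let $(Z_\phi)_{\phi\in\{0,1\}^*}$ be, conditionally on $\mathcal F_\infty$, a centred Gaussian family with $\mathbb E[Z_\phi Z_\psi\mid\mathcal F_\infty]=|[L_\phi,R_\phi)\cap[L_\psi,R_\psi)|-I_\phi I_\psi$, and let $(Y_\phi)$ be i.i.d. standard normal, independent of $(Z_\phi)$ and $\mathcal F_\infty$. Then $$G^{\mathrm{swap}}_\alpha:=\sum_{\phi\in\{\phi(\alpha,k):k\in\mathbb N_0\}}\Big(Y_\phi\frac{I_{\phi0}I_{\phi1}}{I_\phi^{3/2}}+Z_{\phi0}\frac{I_{\phi1}}{I_\phi}+Z_{\phi1}\frac{I_{\phi0}}{I_\phi}-Z_\phi\frac{I_{\phi0}I_{\phi1}}{I_\phi^2}\Big).$$ (c) Let $\varepsilon>0$ and let $\beta:[0,1]^2\to[0,\infty)$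 be measurable and $\varepsilon$-tame, i.e. for $V$ uniform on $[0,1]$ and some $c>0$ we have $\mathbb P(\beta(u,V)\ge x)\le c\,x^{-1/\varepsilon}$ for all $u\in[0,1]$ and all integers $x\ge1$. Then $G^\beta_\infty$ is any process with almost surely càdlàg paths which, conditionally on $\mathcal F_\infty$, is a centred Gaussian process with covariance function $$(\alpha,\gamma)\mapsto\mathrm{Cov}\Big(\sum_{k\ge0}X_{\alpha,k},\sum_{k\ge0}X_{\gamma,k}\,\Big|\,\mathcal F_\infty\Big),\qquad X_{\alpha,k}:=\mathbf 1_{[L_{\alpha,k},R_{\alpha,k})}(V)\,\beta(U_{\tau_{\alpha,k}},V),$$ with $V$ uniform on $[0,1]$ and independent of $(U_i)_{i\in\mathbb N}$. Equip $[0,1]$ with the two random metrics $d_2(\alpha,\gamma):=2^{-J(\alpha,\gamma)}$ and $d_G(\alpha,\gamma):=(\Sigma_{\alpha,\alpha}-2\Sigma_{\alpha,\gamma}+\Sigma_{\gamma,\gamma})^{1/2}$; for all $\alpha,\gamma$, almost surely $d_G(\alpha,\gamma)=\mathbb E[(G_{\alpha,\infty}-G_{\gamma,\infty})^2\mid\mathcal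 F_\infty]^{1/2}$. A function $f$ is Hölder continuous with exponent $\eta>0$ with respect to $d$ if $|f(\alpha)-f(\gamma)|\le C\,d(\alpha,\gamma)^\eta$ for all $\alpha,\gamma\in[0,1]$ and some $C<\infty$. Then: 1. Almost surely, the paths of $G_\infty$ and of $G^{\mathrm{swap}}$ are Hölder continuous with respect to $d_2$ for every exponent $0<\eta<\frac14\log_2\frac32$, and with respect to $d_G$ for every exponent $0<\eta<1$. 2. If $\varepsilon<\frac14$, then almost surely the paths of $G^\beta_\infty$ are Hölder continuous with respect to $d_2$ for every exponent $0<\eta<(1-2\varepsilon)\frac14\log_2\frac32$, and with respect to $d_G$ for every exponent $0<\eta<1-2\varepsilon$. -/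

import Mathlib

open MeasureTheory ProbabilityTheory Filter Topology

noncomputable section

namespace Quickselect

/-! ### The binary search tree of a sequence of keys

A node of the infinite binary tree is a word over `{0, 1} = {false, true}`, stored with its last
letter first: the left child `φ0` of `φ` is `false :: φ`, the right child `φ1` is `true :: φ`.
The keys are `u 0, u 1, u 2, …`. -/

/-- Nodes of the infinite binary tree. -/
abbrev Node := List Bool

/-- The index of the first key that falls into the open interval `(l, r)`. -/
def firstIn (u : ℕ → unitInterval) (l r : unitInterval) : ℕ :=
  sInf {i | l < u i ∧ u i < r}

/-- The pair `(L_φ, R_φ)`. -/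
def endpoints (u : ℕ → unitInterval) : Node → unitInterval × unitInterval
  | [] => (0, 1)
  | false :: φ => ((endpoints u φ).1, u (firstIn u (endpoints u φ).1 (endpoints u φ).2))
  | true :: φ => (u (firstIn u (endpoints u φ).1 (endpoints u φ).2), (endpoints u φ).2)

/-- `L_φ`. -/
def left (u : ℕ → unitInterval) (φ : Node) : unitInterval := (endpoints u φ).1

/-- `R_φ`. -/
def right (u : ℕ → unitInterval) (φ : Node) : unitInterval := (endpoints u φ).2

/-- `τ_φ`, the index of the key stored at the node `φ`. -/
def tau (u : ℕ → unitInterval) (φ : Node) : ℕ := firstIn u (left u φ) (right u φ)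

/-- `U_{τ_φ}`, the key stored at the node `φ`. -/
def pivot (u : ℕ → unitInterval) (φ : Node) : unitInterval := u (tau u φ)

/-- The interval length `I_φ = R_φ - L_φ`. -/
def len (u : ℕ → unitInterval) (φ : Node) : ℝ := (right u φ : ℝ) - (left u φ : ℝ)

open Classical in
/-- `φ(α, k)`, the node at depth `k` on the search path of `α`. -/
def path (u : ℕ → unitInterval) (α : unitInterval) : ℕ → Node
  | 0 => []
  | k + 1 => if α < pivot u (path u α k) then false :: path u α k else true :: path u α k

/-- `J(α, γ) = max {k | τ_{α,k} = τ_{γ,k}}`, with values in `{0, 1, …, ∞}`. -/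
def J (u : ℕ → unitInterval) (α γ : unitInterval) : ℕ∞ :=
  ⨆ (k : ℕ) (_ : tau u (path u α k) = tau u (path u γ k)), (k : ℕ∞)

/-- `S_α = ∑_{k ≥ 0} I_{α,k}`. -/
def S (u : ℕ → unitInterval) (α : unitInterval) : ℝ := ∑' k : ℕ, len u (path u α k)

/-! ### The covariance functions and the two metrics -/

open Classical in
/-- The covariance function of the limit process for the number of key comparisons:
`∑_{k=0}^{J} ∑_{j ≥ 0} I_{α, max j k} + 1_{α ≠ γ} (J + 1) ∑_{j > J} I_{γ,j} - S_α S_γ`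
with `J = J(α, γ)`. -/
def covComp (u : ℕ → unitInterval) (α γ : unitInterval) : ℝ :=
  (∑' k : ℕ, if (k : ℕ∞) ≤ J u α γ then ∑' j : ℕ, len u (path u α (max j k)) else 0)
    + (if α ≠ γ then
        (((J u α γ).toNat : ℝ) + 1) * ∑' j : ℕ, len u (path u γ ((J u α γ).toNat + 1 + j))
      else 0)
    - S u α * S u γ

/-- The contribution `X_{α,k} = 1_{[L_{α,k}, R_{α,k})}(v) β(U_{τ_{α,k}}, v)`. -/
def levelCost (u : ℕ → unitInterval) (β : unitInterval → unitInterval → NNReal)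
    (α : unitInterval) (k : ℕ) (v : unitInterval) : ℝ :=
  (Set.Ico (left u (path u α k)) (right u (path u α k))).indicator
    (fun w => (β (pivot u (path u α k)) w : ℝ)) v

/-- The covariance function of the limit process for the cost function `β`: the covariance of
`∑_k X_{α,k}` and `∑_k X_{γ,k}`, where the keys `u` are frozen and `v` is uniform on `[0,1]`. -/
def covCost (β : unitInterval → unitInterval → NNReal) (u : ℕ → unitInterval)
    (α γ : unitInterval) : ℝ :=
  cov[fun v => ∑' k : ℕ, levelCost u β α k v, fun v => ∑' k : ℕ, levelCost u β γ k v;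
    (volume : Measure unitInterval)]

open Classical in
/-- The ultrametric `d₂(α, γ) = 2^{-J(α, γ)}`. -/
def d2 (u : ℕ → unitInterval) (α γ : unitInterval) : ℝ :=
  if J u α γ = ⊤ then 0 else ((2 : ℝ) ^ (J u α γ).toNat)⁻¹

/-- The canonical metric of the limit process for comparisons: the standard deviation of the
increment between `α` and `γ` under the centred Gaussian law with covariance `covComp u`. -/
def dG (u : ℕ → unitInterval) (α γ : unitInterval) : ℝ :=
  Real.sqrt (covComp u α α - 2 * covComp u α γ + covComp u γ γ)

/-! ### Conditionally Gaussian processes, càdlàg and Hölder paths, tame cost functions -/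

/-- Conditionally on the σ-algebra `F`, the family `X` is a centred Gaussian process with
(random) covariance function `C`: the conditional law given `F` of each finite linear combination
`∑ a_t X_t` is the normal law `N(0, ∑ a_s a_t C_{s,t})`. -/
structure IsMixedCentredGaussian {Ω T : Type*} (F : MeasurableSpace Ω) {mΩ : MeasurableSpace Ω}
    (P : Measure Ω) (X : T → Ω → ℝ) (C : Ω → T → T → ℝ) : Prop where
  measurable : ∀ t, Measurable[mΩ] (X t)
  cond_law : ∀ (A : Finset T) (a : T → ℝ) (B : Set ℝ), MeasurableSet B →
    P⟦{ω | ∑ t ∈ A, a t * X t ω ∈ B} | F⟧ =ᵐ[P]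
      fun ω => (gaussianReal 0 (∑ s ∈ A, ∑ t ∈ A, a s * a t * C ω s t).toNNReal).real B

/-- Right-continuous with left limits. -/
def IsCadlag (f : unitInterval → ℝ) : Prop :=
  ∀ t, ContinuousWithinAt f (Set.Ici t) t ∧ ∃ l : ℝ, Tendsto f (𝓝[<] t) (𝓝 l)

/-- `f` is Hölder continuous with exponent `γ` with respect to the distance function `d`. -/
def IsHolder (d : unitInterval → unitInterval → ℝ) (γ : ℝ) (f : unitInterval → ℝ) : Prop :=
  ∃ C : ℝ, ∀ x y, |f x - f y| ≤ C * d x y ^ γ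

/-- The cost function `β` is `ε`-tame. -/
def IsTame (ε : ℝ) (β : unitInterval → unitInterval → NNReal) : Prop :=
  0 < ε ∧ ∃ c : ℝ, 0 < c ∧ ∀ (u : unitInterval) (x : ℕ), 1 ≤ x →
    (volume : Measure unitInterval).real {v | (x : ℝ) ≤ (β u v : ℝ)} ≤ c * (x : ℝ) ^ (-(1 / ε))

/-! ### The random objects -/

section Random

variable {Ω : Type*}

/-- The sequence of keys at the sample point `ω`. -/
def keys (U : ℕ → Ω → unitInterval) (ω : Ω) : ℕ → unitInterval := fun i => U i ω

/-- `F_∞ = σ(I_φ : φ)`, the σ-algebra of the interval lengths. -/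
@[reducible] def Finf (U : ℕ → Ω → unitInterval) : MeasurableSpace Ω :=
  ⨆ φ : Node, (borel ℝ).comap (fun ω => len (keys U ω) φ)

/-- The covariance function `|[L_φ, R_φ) ∩ [L_ψ, R_ψ)| - I_φ I_ψ` of the family `Z`. -/
def covZ (u : ℕ → unitInterval) (φ ψ : Node) : ℝ :=
  max (min (right u φ : ℝ) (right u ψ) - max (left u φ : ℝ) (left u ψ)) 0 - len u φ * len u ψ

/-- The contribution of the node `φ` to the limit process for swaps. -/
def swapTerm (U : ℕ → Ω → unitInterval) (Z Y : Node → Ω → ℝ) (φ : Node) (ω : Ω) : ℝ :=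
  let I : Node → ℝ := len (keys U ω)
  Y φ ω * (I (false :: φ) * I (true :: φ) / I φ ^ (3 / 2 : ℝ))
    + Z (false :: φ) ω * (I (true :: φ) / I φ)
    + Z (true :: φ) ω * (I (false :: φ) / I φ)
    - Z φ ω * (I (false :: φ) * I (true :: φ) / I φ ^ 2)

/-- The limit process for swaps, the sum of the contributions along the search path of `α`. -/
def Gswap (U : ℕ → Ω → unitInterval) (Z Y : Node → Ω → ℝ) (α : unitInterval) (ω : Ω) : ℝ :=
  ∑' k : ℕ, swapTerm U Z Y (path (keys U ω) α k) ω

/-- `G` is a limit process with conditional covariance function `C`: a process with almost surely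
càdlàg paths that is a mixture of centred Gaussian processes given `F_∞`. -/
structure IsLimitProcess {mΩ : MeasurableSpace Ω} (P : Measure Ω) (U : ℕ → Ω → unitInterval)
    (C : (ℕ → unitInterval) → unitInterval → unitInterval → ℝ)
    (G : unitInterval → Ω → ℝ) : Prop where
  gaussian : IsMixedCentredGaussian (Finf U) P G (fun ω => C (keys U ω))
  cadlag : ∀ᵐ ω ∂P, IsCadlag (fun α => G α ω)

/-- `Z` is conditionally centred Gaussian given `F_∞` with covariance function `covZ`, and the
`Y_φ` are i.i.d. standard normal, independent of `Z` and `F_∞`. -/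
structure IsSwapNoise {mΩ : MeasurableSpace Ω} (P : Measure Ω) (U : ℕ → Ω → unitInterval)
    (Z Y : Node → Ω → ℝ) : Prop where
  gaussian : IsMixedCentredGaussian (Finf U) P Z (fun ω => covZ (keys U ω))
  measurable : ∀ φ, Measurable (Y φ)
  iIndep : iIndepFun Y P
  law : ∀ φ, P.map (Y φ) = gaussianReal 0 1
  indep : Indep (⨆ φ, (borel ℝ).comap (Y φ)) ((⨆ φ, (borel ℝ).comap (Z φ)) ⊔ Finf U) P

/-- Almost surely, the paths of `G` are Hölder continuous with respect to the random distance `d`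
for all positive exponents smaller than `c`. -/
def AlmostSurelyHolderBelow {mΩ : MeasurableSpace Ω} (P : Measure Ω)
    (d : Ω → unitInterval → unitInterval → ℝ) (c : ℝ) (G : unitInterval → Ω → ℝ) : Prop :=
  ∀ᵐ ω ∂P, ∀ γ : ℝ, 0 < γ → γ < c → IsHolder (d ω) γ (fun α => G α ω)

end Random

end Quickselect

end

/-! Regularity of all the processes is governed by the interval lengths of the search tree. A
uniform split multiplies the expected sum of squared lengths by 2/3, so almost surely every squared
length at depth k is at most a random constant times (k+1)^2 (2/3)^k (`lintegral_levelSum_le`,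
`len_sq_le_treeWeight`).

The core estimate is that the oscillation of a path on a node φ is at most C I_φ^(η/2), for every η
below 1, or below 1 - 2ε for a tame cost. It yields both claims. At depth k = J(α,γ) the decay of
the lengths turns I_φ^(η/2) into a power of 2^(-k); one factor 1/2 comes from the square of the
length and one from the standard deviation, whence the constant 1/4 (`GoodKeys.isHolder_d2`). On the
other hand d_G^2 is at least a random constant times the length of the last common node
(`GoodKeys.exists_le_incVar`), so I_φ^(η/2) is bounded by a multiple of d_G^η
(`GoodKeys.isHolder_dG`).

For the càdlàg processes, the covariance is that of the costs of two search paths, comparisons being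
the cost 1 (`GoodKeys.covComp_eq`). Common nodes cancel in an increment, and the remaining L^2 norms
add up to a power of the length of the last common node (`IsTame.momentBound`,
`GoodKeys.exists_incVar_le`). Chaining then runs along the tree: each node gets a representative
from a fixed dense sequence, chosen measurably in F_∞. Gaussian tails at thresholds linear in the
depth beat the 2^n nodes of depth n, so Borel-Cantelli controls all but finitely many increments
(`ae_finite_large_increments`). Telescoping and right-continuity finish
(`GoodKeys.exists_oscillation_le`).

The swap process needs no chaining: by Borel-Cantelli its terms are at most a constant times (n+1)
I_φ^(1/2), and they are summed along the paths (`DenseKeys.abs_swapTerm_le`,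
`GoodKeys.exists_tsum_oscillation_le`). -/

namespace Quickselect

/-! ### Combinatorics of the search tree for a dense sequence of keys -/

/-- Every nondegenerate interval contains a key. -/
def DenseKeys (u : ℕ → unitInterval) : Prop := ∀ l r, l < r → ∃ i, l < u i ∧ u i < r

@[simp] lemma left_nil (u : ℕ → unitInterval) : left u [] = 0 := rfl
@[simp] lemma right_nil (u : ℕ → unitInterval) : right u [] = 1 := rfl
@[simp] lemma left_false (u : ℕ → unitInterval) (φ : Node) :
    left u (false :: φ) = left u φ := rfl
@[simp] lemma right_false (u : ℕ → unitInterval) (φ : Node) :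
    right u (false :: φ) = pivot u φ := rfl
@[simp] lemma left_true (u : ℕ → unitInterval) (φ : Node) :
    left u (true :: φ) = pivot u φ := rfl
@[simp] lemma right_true (u : ℕ → unitInterval) (φ : Node) :
    right u (true :: φ) = right u φ := rfl

variable {u : ℕ → unitInterval}

lemma DenseKeys.firstIn_spec (h : DenseKeys u) {l r : unitInterval} (hlr : l < r) :
    l < u (firstIn u l r) ∧ u (firstIn u l r) < r :=
  Nat.sInf_mem (s := {i | l < u i ∧ u i < r}) (h l r hlr)

lemma DenseKeys.left_lt_right (h : DenseKeys u) : ∀ φ, left u φ < right u φ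
  | [] => by simp
  | false :: φ => (h.firstIn_spec (h.left_lt_right φ)).1
  | true :: φ => (h.firstIn_spec (h.left_lt_right φ)).2

lemma DenseKeys.left_lt_pivot (h : DenseKeys u) (φ : Node) : left u φ < pivot u φ :=
  (h.firstIn_spec (h.left_lt_right φ)).1

lemma DenseKeys.pivot_lt_right (h : DenseKeys u) (φ : Node) : pivot u φ < right u φ :=
  (h.firstIn_spec (h.left_lt_right φ)).2

lemma DenseKeys.len_pos (h : DenseKeys u) (φ : Node) : 0 < len u φ :=
  sub_pos.2 (h.left_lt_right φ)

lemma len_false_add_len_true (u : ℕ → unitInterval) (φ : Node) :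
    len u (false :: φ) + len u (true :: φ) = len u φ := by
  simp [len]

lemma len_le_one (u : ℕ → unitInterval) (φ : Node) : len u φ ≤ 1 := by
  have := (right u φ).2.2
  have := (left u φ).2.1
  unfold len; linarith

lemma DenseKeys.len_cons_lt (h : DenseKeys u) (b : Bool) (φ : Node) :
    len u (b :: φ) < len u φ := by
  have := len_false_add_len_true u φ
  have := h.len_pos (false :: φ)
  have := h.len_pos (true :: φ)
  cases b <;> linarith

/-- `α` belongs to the half-open interval of `φ`, the point `1` being put into the rightmost
intervals. -/
def InNode (u : ℕ → unitInterval) (φ : Node) (α : unitInterval) : Prop :=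
  left u φ ≤ α ∧ (α < right u φ ∨ α = 1 ∧ right u φ = 1)

lemma InNode.le_right {φ : Node} {α : unitInterval} (hα : InNode u φ α) : α ≤ right u φ := by
  rcases hα.2 with b | ⟨-, c⟩
  · exact b.le
  · rw [c]; exact unitInterval.le_one'

lemma inNode_cons_false (h : DenseKeys u) (φ : Node) (α : unitInterval) :
    InNode u (false :: φ) α ↔ InNode u φ α ∧ α < pivot u φ := by
  have h1 := h.pivot_lt_right φ
  have h2 : pivot u φ < 1 := h1.trans_le unitInterval.le_one'
  simp only [InNode, left_false, right_false]
  constructor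
  · rintro ⟨a, b | b⟩
    · exact ⟨⟨a, Or.inl (b.trans h1)⟩, b⟩
    · exact absurd b.2 h2.ne
  · rintro ⟨⟨a, _⟩, c⟩
    exact ⟨a, Or.inl c⟩

lemma inNode_cons_true (h : DenseKeys u) (φ : Node) (α : unitInterval) :
    InNode u (true :: φ) α ↔ InNode u φ α ∧ pivot u φ ≤ α := by
  have h1 := h.left_lt_pivot φ
  simp only [InNode, left_true, right_true]
  constructor
  · rintro ⟨a, b⟩
    exact ⟨⟨h1.le.trans a, b⟩, a⟩
  · rintro ⟨⟨_, b⟩, c⟩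
    exact ⟨c, b⟩

@[simp] lemma length_path (u : ℕ → unitInterval) (α : unitInterval) (k : ℕ) :
    (path u α k).length = k := by
  induction k with
  | zero => rfl
  | succ k ih => rw [path]; split_ifs <;> simp [ih]

@[simp] lemma tail_path (u : ℕ → unitInterval) (α : unitInterval) (k : ℕ) :
    (path u α (k + 1)).tail = path u α k := by
  rw [path]; split_ifs <;> rfl

lemma exists_path_succ (u : ℕ → unitInterval) (α : unitInterval) (k : ℕ) :
    ∃ b, path u α (k + 1) = b :: path u α k := by
  rw [path]; split_ifs
  exacts [⟨_, rfl⟩, ⟨_, rfl⟩]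

lemma inNode_path (h : DenseKeys u) (α : unitInterval) (k : ℕ) : InNode u (path u α k) α := by
  induction k with
  | zero =>
    refine ⟨unitInterval.nonneg', ?_⟩
    rcases eq_or_lt_of_le (unitInterval.le_one' (t := α)) with h1 | h1
    · exact Or.inr ⟨h1, rfl⟩
    · exact Or.inl h1
  | succ k ih =>
    rw [path]
    split_ifs with hα
    · exact (inNode_cons_false h _ _).2 ⟨ih, hα⟩
    · exact (inNode_cons_true h _ _).2 ⟨ih, not_lt.1 hα⟩

/-- Converse of `inNode_path`: the nodes of a fixed depth partition `[0,1]`, and search paths are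
membership in this partition. -/
lemma InNode.path_eq (h : DenseKeys u) {α : unitInterval} :
    ∀ {φ : Node}, InNode u φ α → path u α φ.length = φ
  | [], _ => rfl
  | false :: φ, hα => by
    obtain ⟨h1, h2⟩ := (inNode_cons_false h _ _).1 hα
    rw [List.length_cons, path, h1.path_eq h, if_pos h2]
  | true :: φ, hα => by
    obtain ⟨h1, h2⟩ := (inNode_cons_true h _ _).1 hα
    rw [List.length_cons, path, h1.path_eq h, if_neg (not_lt.2 h2)]

lemma inNode_pivot (h : DenseKeys u) (φ : Node) : InNode u φ (pivot u φ) :=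
  ⟨(h.left_lt_pivot φ).le, Or.inl (h.pivot_lt_right φ)⟩

lemma path_eq_of_le {α γ : unitInterval} {j k : ℕ} (hjk : j ≤ k)
    (e : path u α k = path u γ k) : path u α j = path u γ j := by
  induction k, hjk using Nat.le_induction with
  | base => exact e
  | succ k _ ih =>
    apply ih
    rw [← tail_path u α k, ← tail_path u γ k, e]

/-- The key stored at a node lies inside its interval, so its own search path recovers the node.
Hence `J` is the length of the common initial part of two paths. -/
lemma tau_path_eq_iff (h : DenseKeys u) (α γ : unitInterval) (k : ℕ) :
    tau u (path u α k) = tau u (path u γ k) ↔ path u α k = path u γ k := by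
  refine ⟨fun e => ?_, fun e => by rw [e]⟩
  have e' : pivot u (path u α k) = pivot u (path u γ k) := congrArg u e
  have h1 := (inNode_pivot h (path u α k)).path_eq h
  have h2 := (inNode_pivot h (path u γ k)).path_eq h
  rw [length_path] at h1 h2
  rw [← h1, ← h2, e']

lemma J_eq_top (u : ℕ → unitInterval) (α : unitInterval) : J u α α = ⊤ := by
  rw [J, ENat.eq_top_iff_forall_ge]
  intro m
  exact le_iSup₂_of_le m rfl le_rfl

lemma J_eq_coe (h : DenseKeys u) {α γ : unitInterval} {k : ℕ}
    (e : path u α k = path u γ k) (ne : path u α (k + 1) ≠ path u γ (k + 1)) :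
    J u α γ = k := by
  apply le_antisymm
  · refine iSup₂_le fun j hj => ?_
    rw [tau_path_eq_iff h] at hj
    norm_cast
    by_contra! hlt
    exact ne (path_eq_of_le hlt hj)
  · exact le_iSup₂_of_le k ((tau_path_eq_iff h _ _ _).2 e) le_rfl

/-- If the lengths of the intervals tend to zero, then the search paths of distinct points
split. -/
lemma exists_split (h : DenseKeys u) (hlen : ∀ δ > 0, ∃ k : ℕ, ∀ φ : Node, φ.length = k →
    len u φ < δ) {α γ : unitInterval} (ne : α ≠ γ) :
    ∃ k, path u α k = path u γ k ∧ path u α (k + 1) ≠ path u γ (k + 1) := by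
  obtain ⟨k, hk⟩ := hlen |(α : ℝ) - γ| (abs_pos.2 (sub_ne_zero.2 fun e => ne (Subtype.ext e)))
  have hne : path u α k ≠ path u γ k := by
    intro e
    have h1 := inNode_path h α k
    have h2 := inNode_path h γ k
    rw [← e] at h2
    have h3 := hk _ (length_path u α k)
    have a1 : (left u (path u α k) : ℝ) ≤ α := h1.1
    have a2 : (left u (path u α k) : ℝ) ≤ γ := h2.1
    have a3 : (α : ℝ) ≤ right u (path u α k) := h1.le_right
    have a4 : (γ : ℝ) ≤ right u (path u α k) := h2.le_right
    rw [len] at h3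
    rcases abs_cases ((α : ℝ) - γ) with hc | hc <;> linarith [hc.1]
  classical
  have hex : ∃ k, path u α k ≠ path u γ k := ⟨k, hne⟩
  have h0 : Nat.find hex ≠ 0 := fun e0 => Nat.find_spec hex (by rw [e0]; rfl)
  obtain ⟨m, hm⟩ := Nat.exists_eq_succ_of_ne_zero h0
  refine ⟨m, ?_, ?_⟩
  · by_contra hc
    exact Nat.find_min hex (m := m) (by omega) hc
  · have := Nat.find_spec hex
    rwa [hm] at this

/-! ### Measurability of the tree -/

lemma measurable_sInf_nat {X : Type*} [MeasurableSpace X] {p : X → ℕ → Prop}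
    (hp : ∀ i, MeasurableSet {x | p x i}) : Measurable fun x => sInf {i | p x i} := by
  refine measurable_to_countable' fun n => ?_
  -- The second set accounts for the default value `0` of the infimum of the empty set.
  have key : (fun x => sInf {i | p x i}) ⁻¹' {n} =
      ({x | p x n} ∩ ⋂ m < n, {x | p x m}ᶜ) ∪ ({x | n = 0} ∩ ⋂ m, {x | p x m}ᶜ) := by
    ext x
    simp only [Set.mem_preimage, Set.mem_singleton_iff, Set.mem_union, Set.mem_inter_iff,
      Set.mem_ofPred_eq, Set.mem_iInter, Set.mem_compl_iff]
    constructor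
    · intro e
      by_cases hne : {i | p x i}.Nonempty
      · left
        have h1 : sInf {i | p x i} ∈ {i | p x i} := Nat.sInf_mem hne
        rw [e] at h1
        exact ⟨h1, fun m hm => Nat.notMem_of_lt_sInf (s := {i | p x i}) (e ▸ hm)⟩
      · right
        rw [Set.not_nonempty_iff_eq_empty] at hne
        refine ⟨?_, fun m hm => ?_⟩
        · rw [← e, hne, Nat.sInf_empty]
        · have : m ∈ {i | p x i} := hm
          simp [hne] at this
    · rintro (⟨h1, h2⟩ | ⟨h1, h2⟩)
      · apply le_antisymm
        · exact Nat.sInf_le (s := {i | p x i}) h1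
        · by_contra! hlt
          exact h2 _ hlt (Nat.sInf_mem (s := {i | p x i}) ⟨n, h1⟩)
      · have : {i | p x i} = ∅ := by ext m; simpa using h2 m
        rw [this, Nat.sInf_empty, h1]
  rw [key]
  refine MeasurableSet.union ?_ ?_
  · exact (hp n).inter (MeasurableSet.iInter fun m => MeasurableSet.iInter fun _ => (hp m).compl)
  · exact (MeasurableSet.const _).inter (MeasurableSet.iInter fun m => (hp m).compl)

lemma measurable_key_firstIn :
    Measurable fun p : (ℕ → unitInterval) × unitInterval × unitInterval =>
      p.1 (firstIn p.1 p.2.1 p.2.2) := by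
  have h1 : Measurable fun p : (ℕ → unitInterval) × unitInterval × unitInterval =>
      firstIn p.1 p.2.1 p.2.2 := by
    refine measurable_sInf_nat fun i => ?_
    have hi : Measurable fun p : (ℕ → unitInterval) × unitInterval × unitInterval => p.1 i := by
      fun_prop
    have hl : Measurable fun p : (ℕ → unitInterval) × unitInterval × unitInterval => p.2.1 := by
      fun_prop
    have hr : Measurable fun p : (ℕ → unitInterval) × unitInterval × unitInterval => p.2.2 := by
      fun_prop
    have h1 : MeasurableSet {p : (ℕ → unitInterval) × unitInterval × unitInterval |
      p.2.1 < p.1 i} := measurableSet_lt hl hi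
    have h2 : MeasurableSet {p : (ℕ → unitInterval) × unitInterval × unitInterval |
      p.1 i < p.2.2} := measurableSet_lt hi hr
    exact h1.inter h2
  have h2 : Measurable fun p : ℕ × (ℕ → unitInterval) => p.2 p.1 :=
    measurable_from_prod_countable_right fun i => measurable_pi_apply i
  exact h2.comp (h1.prodMk measurable_fst)

lemma measurable_endpoints (φ : Node) :
    Measurable fun u : ℕ → unitInterval => endpoints u φ := by
  induction φ with
  | nil => exact measurable_const
  | cons b φ ih =>
    have hp : Measurable fun u : ℕ → unitInterval =>
        u (firstIn u (endpoints u φ).1 (endpoints u φ).2) :=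
      measurable_key_firstIn.comp (measurable_id.prodMk ih)
    cases b
    · exact (measurable_fst.comp ih).prodMk hp
    · exact hp.prodMk (measurable_snd.comp ih)

lemma measurable_len (φ : Node) : Measurable fun u : ℕ → unitInterval => len u φ :=
  (measurable_subtype_coe.comp (measurable_snd.comp (measurable_endpoints φ))).sub
    (measurable_subtype_coe.comp (measurable_fst.comp (measurable_endpoints φ)))

/-! ### The expected sum of the squared lengths of a level of the tree -/

/-- The sum of the squared lengths of the intervals obtained from `(l, r)` by splitting `k`
times. -/
noncomputable def levelSum (u : ℕ → unitInterval) : ℕ → unitInterval → unitInterval → ENNReal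
  | 0, l, r => ENNReal.ofReal (((r : ℝ) - l) ^ 2)
  | k + 1, l, r => levelSum u k l (u (firstIn u l r)) + levelSum u k (u (firstIn u l r)) r

lemma measurable_levelSum (k : ℕ) :
    Measurable fun p : (ℕ → unitInterval) × unitInterval × unitInterval =>
      levelSum p.1 k p.2.1 p.2.2 := by
  induction k with
  | zero => simp only [levelSum]; fun_prop
  | succ k ih =>
    have hp := measurable_key_firstIn
    have h1 : Measurable fun p : (ℕ → unitInterval) × unitInterval × unitInterval =>
      (p.1, p.2.1, p.1 (firstIn p.1 p.2.1 p.2.2)) := by fun_prop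
    have h2 : Measurable fun p : (ℕ → unitInterval) × unitInterval × unitInterval =>
      (p.1, p.1 (firstIn p.1 p.2.1 p.2.2), p.2.2) := by fun_prop
    exact (ih.comp h1).add (ih.comp h2)

/-- The subtree below a node is part of the subtree below its parent, one level deeper; the
induction trades letters of `φ` for levels. -/
lemma levelSum_left_right_le (u : ℕ → unitInterval) (k : ℕ) (φ : Node) :
    levelSum u k (left u φ) (right u φ) ≤ levelSum u (k + φ.length) 0 1 := by
  induction φ generalizing k with
  | nil => rfl
  | cons b φ ih =>
    refine le_trans ?_ ((ih (k + 1)).trans_eq (by rw [List.length_cons, add_assoc, add_comm 1]))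
    rw [levelSum]
    cases b
    · exact le_self_add
    · exact le_add_self

lemma ofReal_len_sq_le (u : ℕ → unitInterval) (φ : Node) :
    ENNReal.ofReal (len u φ ^ 2) ≤ levelSum u φ.length 0 1 := by
  simpa [levelSum, len] using levelSum_left_right_le u 0 φ

/-- A crude bound, used only to know that the expectation in `lintegral_levelSum_le` is finite and
may be subtracted. -/
lemma levelSum_le (u : ℕ → unitInterval) (k : ℕ) (l r : unitInterval) :
    levelSum u k l r ≤ 2 ^ k := by
  induction k generalizing l r with
  | zero =>
    rw [levelSum, pow_zero, ← ENNReal.ofReal_one]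
    apply ENNReal.ofReal_le_ofReal
    have := l.2.1; have := l.2.2; have := r.2.1; have := r.2.2
    rw [sq_le_one_iff_abs_le_one, abs_le]
    constructor <;> linarith
  | succ k ih =>
    rw [levelSum, pow_succ, mul_two]
    exact add_le_add (ih _ _) (ih _ _)

/-- Put a new key in front of the sequence of keys. -/
def consKey (x : unitInterval) (s : ℕ → unitInterval) : ℕ → unitInterval
  | 0 => x
  | i + 1 => s i

lemma measurable_consKey :
    Measurable fun p : unitInterval × (ℕ → unitInterval) => consKey p.1 p.2 := by
  refine measurable_pi_iff.2 fun i => ?_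
  cases i with
  | zero => exact measurable_fst
  | succ i => exact (measurable_pi_apply i).comp measurable_snd

lemma firstIn_consKey_of_mem {x l r : unitInterval} (s : ℕ → unitInterval) (h1 : l < x)
    (h2 : x < r) : firstIn (consKey x s) l r = 0 :=
  Nat.sInf_eq_zero.2 (Or.inl ⟨h1, h2⟩)

/-- A key outside `(l, r)` is invisible to the search there and only shifts the index by one.
Density excludes the default value of `firstIn` on an empty set. -/
lemma consKey_firstIn_of_notMem {x l r : unitInterval} {s : ℕ → unitInterval}
    (hs : DenseKeys s) (hlr : l < r) (hx : ¬ (l < x ∧ x < r)) :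
    consKey x s (firstIn (consKey x s) l r) = s (firstIn s l r) := by
  have key : firstIn (consKey x s) l r = firstIn s l r + 1 := by
    apply le_antisymm
    · exact Nat.sInf_le (s := {i | l < consKey x s i ∧ consKey x s i < r}) (hs.firstIn_spec hlr)
    · have hmem : firstIn (consKey x s) l r ∈ {i | l < consKey x s i ∧ consKey x s i < r} :=
        Nat.sInf_mem ⟨firstIn s l r + 1, hs.firstIn_spec hlr⟩
      rcases hn : firstIn (consKey x s) l r with _ | n
      · rw [hn] at hmem
        exact absurd hmem hx
      · rw [hn] at hmem
        exact Nat.succ_le_succ (Nat.sInf_le (s := {i | l < s i ∧ s i < r}) hmem)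
  rw [key]; rfl

lemma levelSum_consKey_of_notMem {x : unitInterval} {s : ℕ → unitInterval}
    (hs : DenseKeys s) (k : ℕ) {l r : unitInterval} (hlr : l < r) (hx : ¬ (l < x ∧ x < r)) :
    levelSum (consKey x s) k l r = levelSum s k l r := by
  induction k generalizing l r with
  | zero => rfl
  | succ k ih =>
    obtain ⟨h1, h2⟩ := hs.firstIn_spec hlr
    rw [levelSum, levelSum, consKey_firstIn_of_notMem hs hlr hx,
      ih h1 fun h => hx ⟨h.1, h.2.trans h2⟩, ih h2 fun h => hx ⟨h1.trans h.1, h.2⟩]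

/-- After the split, `x` is an endpoint of both parts and interior to neither, so the later keys
alone act on them. -/
lemma levelSum_consKey_of_mem {x l r : unitInterval} {s : ℕ → unitInterval}
    (hs : DenseKeys s) (k : ℕ) (h1 : l < x) (h2 : x < r) :
    levelSum (consKey x s) (k + 1) l r = levelSum s k l x + levelSum s k x r := by
  rw [levelSum, firstIn_consKey_of_mem s h1 h2]
  change levelSum (consKey x s) k l x + levelSum (consKey x s) k x r = _
  rw [levelSum_consKey_of_notMem hs k h1 fun h => lt_irrefl _ h.2,
    levelSum_consKey_of_notMem hs k h2 fun h => lt_irrefl _ h.1]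

/-- The law of the sequence of keys. -/
noncomputable abbrev keyLaw : Measure (ℕ → unitInterval) := Measure.infinitePi fun _ => volume

/-- Stands in for conditioning on the first key: it is uniform and independent of the remaining
keys, which have the same law as the whole sequence. -/
lemma map_consKey :
    (volume.prod keyLaw).map (fun p : unitInterval × (ℕ → unitInterval) => consKey p.1 p.2)
      = keyLaw := by
  classical
  refine Measure.eq_infinitePi _ fun s t ht => ?_
  -- The cylinder is padded by full factors to an initial segment of coordinates, so that coordinate
  -- `0` can be split off.
  set t' : ℕ → Set unitInterval := fun i => if i ∈ s then t i else Set.univ with ht'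
  have ht'm : ∀ i, MeasurableSet (t' i) := fun i => by
    simp only [ht']; split_ifs
    · exact ht i
    · exact MeasurableSet.univ
  obtain ⟨N, hN⟩ : ∃ N, s ⊆ Finset.range (N + 1) :=
    ⟨s.sup id, fun i hi => Finset.mem_range.2 (Nat.lt_succ_of_le (Finset.le_sup (f := id) hi))⟩
  have e1 : Set.pi (s : Set ℕ) t = Set.pi (Finset.range (N + 1) : Set ℕ) t' := by
    ext f
    simp only [Set.mem_pi, ht']
    constructor
    · intro h i _
      split_ifs with hi
      · exact h i hi
      · trivial
    · intro h i hi
      have := h i (hN hi)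
      rwa [if_pos (by exact hi)] at this
  have e2 : ∏ i ∈ s, (volume : Measure unitInterval) (t i)
      = ∏ i ∈ Finset.range (N + 1), volume (t' i) := by
    rw [← Finset.prod_subset hN fun i _ hi => by simp [ht', hi]]
    exact Finset.prod_congr rfl fun i hi => by simp [ht', hi]
  have e3 : (fun p : unitInterval × (ℕ → unitInterval) => consKey p.1 p.2) ⁻¹'
      Set.pi (Finset.range (N + 1) : Set ℕ) t'
      = t' 0 ×ˢ Set.pi (Finset.range N : Set ℕ) (fun i => t' (i + 1)) := by
    ext ⟨x, f⟩
    simp only [Set.mem_preimage, Set.mem_pi, Finset.coe_range, Set.mem_Iio, Set.mem_prod]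
    constructor
    · exact fun h => ⟨h 0 (by omega), fun i hi => h (i + 1) (by omega)⟩
    · rintro ⟨h0, h1⟩ (_ | i) hi
      · exact h0
      · exact h1 i (by omega)
  rw [e1, e2, Measure.map_apply measurable_consKey
    (MeasurableSet.pi (Finset.countable_toSet _) fun i _ => ht'm i), e3, Measure.prod_prod,
    Measure.infinitePi_pi _ fun i _ => ht'm _, Finset.prod_range_succ', mul_comm]

/-- The first `n` keys all miss the interval with probability `(1 - (r - l)) ^ n`. -/
lemma ae_exists_key_between {l r : unitInterval} (hlr : l < r) :
    ∀ᵐ u ∂keyLaw, ∃ i, l < u i ∧ u i < r := by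
  rw [ae_iff]
  have hd : (0 : ℝ) < r - l := sub_pos.2 hlr
  have hd1 : (r : ℝ) - l ≤ 1 := by have := l.2.1; have := r.2.2; linarith
  have hcompl : (volume : Measure unitInterval) (Set.Ioo l r)ᶜ
      = ENNReal.ofReal (1 - (r - l)) := by
    rw [prob_compl_eq_one_sub measurableSet_Ioo, unitInterval.volume_Ioo,
      ENNReal.ofReal_sub _ hd.le, ENNReal.ofReal_one]
  have hle : ∀ n : ℕ, keyLaw {u | ¬ ∃ i, l < u i ∧ u i < r}
      ≤ ENNReal.ofReal (1 - (r - l)) ^ n := by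
    intro n
    calc keyLaw {u | ¬ ∃ i, l < u i ∧ u i < r}
        ≤ keyLaw (Set.pi (Finset.range n : Set ℕ) fun _ => (Set.Ioo l r)ᶜ) :=
          measure_mono fun u hu i _ hi => hu ⟨i, hi⟩
      _ = _ := by
          rw [Measure.infinitePi_pi _ fun i _ => measurableSet_Ioo.compl, hcompl]
          simp
  have hlim : Tendsto (fun n => ENNReal.ofReal (1 - ((r : ℝ) - l)) ^ n) atTop (𝓝 0) :=
    ENNReal.tendsto_pow_atTop_nhds_zero_of_lt_one (by
      rw [ENNReal.ofReal_lt_one]; linarith)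
  exact le_antisymm (ge_of_tendsto' hlim hle) bot_le

lemma ae_denseKeys : ∀ᵐ u ∂keyLaw, DenseKeys u := by
  obtain ⟨D, hDc, hDd⟩ := TopologicalSpace.exists_countable_dense unitInterval
  -- Only countably many null sets are discarded; every interval contains one with endpoints in `D`.
  have : ∀ᵐ u ∂keyLaw, ∀ a ∈ D, ∀ b ∈ D, a < b → ∃ i, a < u i ∧ u i < b := by
    rw [ae_ball_iff hDc]
    intro a _
    rw [ae_ball_iff hDc]
    intro b _
    rw [ae_all_iff]
    exact fun hab => ae_exists_key_between hab
  filter_upwards [this] with u hu l r hlr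
  obtain ⟨a, ha, h1, h2⟩ := hDd.exists_between hlr
  obtain ⟨b, hb, h3, h4⟩ := hDd.exists_between h2
  obtain ⟨i, h5, h6⟩ := hu a ha b hb h3
  exact ⟨i, h1.trans h5, h6.trans h4⟩

lemma setLIntegral_sq_add_sq {l r : unitInterval} (hlr : l < r) {c : ℝ} (hc : 0 ≤ c) :
    ∫⁻ x in Set.Ioo l r, ENNReal.ofReal (c * (((x : ℝ) - l) ^ 2 + ((r : ℝ) - x) ^ 2))
      = ENNReal.ofReal (c * (2 / 3) * ((r : ℝ) - l) ^ 3) := by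
  have hlr' : (l : ℝ) ≤ r := hlr.le
  have e1 : Set.Ioo l r = ((↑) : unitInterval → ℝ) ⁻¹' Set.Ioo (l : ℝ) r := rfl
  rw [e1, unitInterval.measurePreserving_coe.setLIntegral_comp_preimage measurableSet_Ioo
    (f := fun x : ℝ => ENNReal.ofReal (c * ((x - l) ^ 2 + ((r : ℝ) - x) ^ 2))) (by fun_prop),
    Measure.restrict_restrict measurableSet_Ioo,
    Set.inter_eq_left.2 (Set.Ioo_subset_Icc_self.trans (Set.Icc_subset_Icc l.2.1 r.2.2)),
    ← ofReal_integral_eq_lintegral_ofReal]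
  · congr 1
    rw [← integral_Ioc_eq_integral_Ioo, ← intervalIntegral.integral_of_le hlr']
    have h1 : ∀ x ∈ Set.uIcc (l : ℝ) r, HasDerivAt
        (fun x : ℝ => c * ((x - l) ^ 3 / 3 - ((r : ℝ) - x) ^ 3 / 3))
        (c * ((x - l) ^ 2 + ((r : ℝ) - x) ^ 2)) x := by
      intro x _
      have a1 : HasDerivAt (fun x : ℝ => x - (l : ℝ)) 1 x := (hasDerivAt_id x).sub_const _
      have a2 : HasDerivAt (fun x : ℝ => (r : ℝ) - x) (-1) x := (hasDerivAt_id x).const_sub _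
      refine HasDerivAt.congr_deriv
        ((((a1.pow 3).div_const 3).sub ((a2.pow 3).div_const 3)).const_mul c) ?_
      push_cast
      ring
    rw [intervalIntegral.integral_eq_sub_of_hasDerivAt h1
      ((by fun_prop : Continuous fun x : ℝ => c * ((x - l) ^ 2 + ((r : ℝ) - x) ^ 2)
        ).intervalIntegrable _ _)]
    ring
  · exact ((by fun_prop : Continuous fun x : ℝ => c * ((x - l) ^ 2 + ((r : ℝ) - x) ^ 2)
      ).integrableOn_Icc (a := (l : ℝ)) (b := r)).mono_set Set.Ioo_subset_Icc_self
  · exact ae_of_all _ fun x => by positivity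

lemma measurable_levelSum_apply (k : ℕ) (l r : unitInterval) :
    Measurable fun u : ℕ → unitInterval => levelSum u k l r :=
  (measurable_levelSum k).comp (measurable_id.prodMk (measurable_const (a := (l, r))))

/-- Each split of an interval by a uniform point multiplies the expected sum of the squared lengths
by `2/3`. -/
lemma lintegral_levelSum_le (k : ℕ) {l r : unitInterval} (hlr : l < r) :
    ∫⁻ u, levelSum u k l r ∂keyLaw ≤ ENNReal.ofReal ((2 / 3) ^ k * ((r : ℝ) - l) ^ 2) := by
  induction k generalizing l r with
  | zero => simp [levelSum]
  | succ k ih =>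
    have hd : (0 : ℝ) < r - l := sub_pos.2 hlr
    have hd1 : (r : ℝ) - l ≤ 1 := by have := l.2.1; have := r.2.2; linarith
    set A := ∫⁻ u, levelSum u (k + 1) l r ∂keyLaw with hA
    have hAfin : A ≠ ⊤ := by
      refine ne_top_of_le_ne_top (b := (2 : ENNReal) ^ (k + 1)) (by finiteness) ?_
      calc A ≤ ∫⁻ _, 2 ^ (k + 1) ∂keyLaw := lintegral_mono fun u => levelSum_le u _ _ _
        _ = _ := by simp
    have step1 : A = ∫⁻ x, ∫⁻ s, levelSum (consKey x s) (k + 1) l r ∂keyLaw := by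
      rw [hA]
      conv_lhs => rw [← map_consKey]
      rw [lintegral_map (measurable_levelSum_apply _ _ _) measurable_consKey]
      exact lintegral_prod (fun p : unitInterval × (ℕ → unitInterval) =>
        levelSum (consKey p.1 p.2) (k + 1) l r)
        ((measurable_levelSum_apply (k + 1) l r).comp measurable_consKey).aemeasurable
    -- If the first key hits `(l, r)`, it splits the interval and the induction hypothesis applies
    -- to both parts. Otherwise, with probability `1 - (r - l)`, it has no effect and the
    -- expectation is again `A`.
    have step2 : A ≤ ENNReal.ofReal ((2 / 3) ^ (k + 1) * ((r : ℝ) - l) ^ 3)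
        + A * ENNReal.ofReal (1 - ((r : ℝ) - l)) := by
      calc A = ∫⁻ x, ∫⁻ s, levelSum (consKey x s) (k + 1) l r ∂keyLaw := step1
        _ = (∫⁻ x in Set.Ioo l r, ∫⁻ s, levelSum (consKey x s) (k + 1) l r ∂keyLaw)
            + ∫⁻ x in (Set.Ioo l r)ᶜ, ∫⁻ s, levelSum (consKey x s) (k + 1) l r ∂keyLaw :=
          (lintegral_add_compl _ measurableSet_Ioo).symm
        _ ≤ (∫⁻ x in Set.Ioo l r, ENNReal.ofReal ((2 / 3) ^ k *
              (((x : ℝ) - l) ^ 2 + ((r : ℝ) - x) ^ 2)))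
            + ∫⁻ x in (Set.Ioo l r)ᶜ, A := by
          refine add_le_add (setLIntegral_mono (by fun_prop) fun x hx => ?_)
            (setLIntegral_mono measurable_const fun x hx => ?_)
          · calc ∫⁻ s, levelSum (consKey x s) (k + 1) l r ∂keyLaw
                = ∫⁻ s, (levelSum s k l x + levelSum s k x r) ∂keyLaw := by
                  refine lintegral_congr_ae ?_
                  filter_upwards [ae_denseKeys] with s hs
                  exact levelSum_consKey_of_mem hs k hx.1 hx.2
              _ = _ := lintegral_add_left (measurable_levelSum_apply _ _ _) _
              _ ≤ _ := add_le_add (ih hx.1) (ih hx.2)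
              _ = _ := by
                  rw [← ENNReal.ofReal_add (by positivity) (by positivity), mul_add]
          · refine (lintegral_congr_ae ?_).le
            filter_upwards [ae_denseKeys] with s hs
            exact levelSum_consKey_of_notMem hs _ hlr hx
        _ = _ := by
          rw [setLIntegral_sq_add_sq hlr (by positivity), setLIntegral_const,
            prob_compl_eq_one_sub measurableSet_Ioo, unitInterval.volume_Ioo,
            ENNReal.ofReal_sub _ hd.le, ENNReal.ofReal_one, pow_succ (2 / 3 : ℝ) k]
    clear_value A
    -- Since `A` is finite, its multiple on the right can be moved to the left; dividing by `r - l`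
    -- gives the claim.
    lift A to NNReal using hAfin
    rw [← ENNReal.ofReal_coe_nnreal, ← ENNReal.ofReal_mul A.coe_nonneg, ← ENNReal.ofReal_add
      (by positivity) (mul_nonneg A.coe_nonneg (by linarith)),
      ENNReal.ofReal_le_ofReal_iff (add_nonneg (by positivity)
        (mul_nonneg A.coe_nonneg (by linarith)))] at step2
    rw [← ENNReal.ofReal_coe_nnreal]
    apply ENNReal.ofReal_le_ofReal
    refine le_of_mul_le_mul_left ?_ hd
    nlinarith

/-- The weighted sum of the squared lengths of all intervals of the tree. -/
noncomputable def treeWeight (u : ℕ → unitInterval) : ENNReal :=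
  ∑' k : ℕ, ENNReal.ofReal ((3 / 2) ^ k / ((k : ℝ) + 1) ^ 2) * levelSum u k 0 1

lemma measurable_treeWeight : Measurable treeWeight :=
  Measurable.tsum fun k => (measurable_levelSum_apply k 0 1).const_mul _

lemma summable_inv_succ_sq : Summable fun k : ℕ => (((k : ℝ) + 1) ^ 2)⁻¹ := by
  have := (summable_nat_add_iff 1).2 (Real.summable_nat_pow_inv (p := 2) |>.2 one_lt_two)
  simpa using this

/-- The weights cancel the decay `(2/3) ^ k`, so the `k`-th term has expectation at most `1 / (k +
1) ^ 2`. -/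
lemma lintegral_treeWeight_ne_top : ∫⁻ u, treeWeight u ∂keyLaw ≠ ⊤ := by
  refine ne_top_of_le_ne_top summable_inv_succ_sq.tsum_ofReal_ne_top ?_
  unfold treeWeight
  rw [lintegral_tsum fun k => 
    ((measurable_levelSum_apply k 0 1).const_mul _).aemeasurable]
  refine ENNReal.tsum_le_tsum fun k => ?_
  calc _ = ENNReal.ofReal ((3 / 2) ^ k / ((k : ℝ) + 1) ^ 2) * ∫⁻ u, levelSum u k 0 1 ∂keyLaw :=
        lintegral_const_mul _ (measurable_levelSum_apply k 0 1)
    _ ≤ ENNReal.ofReal ((3 / 2) ^ k / ((k : ℝ) + 1) ^ 2) *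
          ENNReal.ofReal ((2 / 3) ^ k * ((1 : unitInterval) - (0 : unitInterval) : ℝ) ^ 2) := by
        gcongr
        exact lintegral_levelSum_le k (by exact zero_lt_one)
    _ = _ := by
        rw [← ENNReal.ofReal_mul (by positivity)]
        congr 1
        have : ((3 : ℝ) / 2) ^ k * (2 / 3) ^ k = 1 := by rw [← mul_pow]; norm_num
        simp only [Set.Icc.coe_one, Set.Icc.coe_zero, sub_zero, one_pow, mul_one]
        rw [div_mul_eq_mul_div, this, one_div]

lemma len_sq_le_treeWeight {u : ℕ → unitInterval} (h : treeWeight u ≠ ⊤) (φ : Node) :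
    len u φ ^ 2 ≤ (treeWeight u).toReal * (φ.length + 1) ^ 2 * (2 / 3) ^ φ.length := by
  have h1 : ENNReal.ofReal ((3 / 2) ^ φ.length / ((φ.length : ℝ) + 1) ^ 2) *
      ENNReal.ofReal (len u φ ^ 2) ≤ treeWeight u :=
    (mul_le_mul_right (ofReal_len_sq_le u φ) _).trans (ENNReal.le_tsum φ.length)
  rw [← ENNReal.ofReal_mul (by positivity), ENNReal.ofReal_le_iff_le_toReal h] at h1
  have e : ((3 : ℝ) / 2) ^ φ.length * (2 / 3) ^ φ.length = 1 := by rw [← mul_pow]; norm_num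
  calc len u φ ^ 2 = ((3 / 2) ^ φ.length / ((φ.length : ℝ) + 1) ^ 2 * len u φ ^ 2)
        * (φ.length + 1) ^ 2 * (2 / 3) ^ φ.length := by
        field_simp
        rw [mul_assoc, e, mul_one]
    _ ≤ _ := by gcongr

lemma ae_treeWeight_ne_top : ∀ᵐ u ∂keyLaw, treeWeight u ≠ ⊤ := by
  filter_upwards [ae_lt_top measurable_treeWeight lintegral_treeWeight_ne_top] with u hu
  exact hu.ne

/-! ### Decay of the interval lengths -/

/-- The almost sure properties of the keys: they are dense and the interval lengths decay
geometrically in the depth. -/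
structure GoodKeys (u : ℕ → unitInterval) : Prop where
  dense : DenseKeys u
  decay : treeWeight u ≠ ⊤

lemma ae_goodKeys : ∀ᵐ u ∂keyLaw, GoodKeys u := by
  filter_upwards [ae_denseKeys, ae_treeWeight_ne_top] with u h1 h2 using ⟨h1, h2⟩

lemma exists_pow_mul_pow_le (p : ℕ) {r : ℝ} (hr0 : 0 < r) (hr1 : r < 1) :
    ∃ C : ℝ, 0 < C ∧ ∀ k : ℕ, ((k : ℝ) + 1) ^ p * r ^ k ≤ C := by
  have h := tendsto_pow_const_mul_const_pow_of_lt_one p hr0.le hr1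
  obtain ⟨C, hC⟩ := h.bddAbove_range
  refine ⟨(|C| + 1) / r, by positivity, fun k => ?_⟩
  rw [le_div_iff₀ hr0]
  have h1 := hC (Set.mem_range_self (k + 1))
  push_cast at h1
  calc ((k : ℝ) + 1) ^ p * r ^ k * r = ((k : ℝ) + 1) ^ p * r ^ (k + 1) := by ring
    _ ≤ |C| + 1 := h1.trans ((le_abs_self C).trans (by linarith))

lemma DenseKeys.len_rpow_le {u : ℕ → unitInterval} (h : DenseKeys u) (hw : treeWeight u ≠ ⊤)
    {δ : ℝ} (hδ : 0 ≤ δ) (φ : Node) :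
    len u φ ^ δ ≤ (treeWeight u).toReal ^ (δ / 2) * ((φ.length : ℝ) + 1) ^ δ
      * (((2 : ℝ) / 3) ^ (δ / 2)) ^ φ.length := by
  have h0 := (h.len_pos φ).le
  calc len u φ ^ δ = (len u φ ^ 2) ^ (δ / 2) := by
        rw [← Real.rpow_natCast, ← Real.rpow_mul h0]; congr 1; push_cast; ring
    _ ≤ ((treeWeight u).toReal * (φ.length + 1) ^ 2 * (2 / 3) ^ φ.length) ^ (δ / 2) :=
        Real.rpow_le_rpow (by positivity) (len_sq_le_treeWeight hw φ) (by positivity)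
    _ = _ := by
        have e1 : (((φ.length : ℝ) + 1) ^ 2) ^ (δ / 2) = ((φ.length : ℝ) + 1) ^ δ := by
          rw [← Real.rpow_natCast, ← Real.rpow_mul (by positivity)]; congr 1; push_cast; ring
        have e2 : (((2 : ℝ) / 3) ^ φ.length) ^ (δ / 2) = (((2 : ℝ) / 3) ^ (δ / 2)) ^ φ.length := by
          rw [← Real.rpow_natCast, ← Real.rpow_natCast, ← Real.rpow_mul (by positivity),
            ← Real.rpow_mul (by positivity), mul_comm]
        rw [Real.mul_rpow (by positivity) (by positivity), Real.mul_rpow (by positivity)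
          (by positivity), e1, e2]

/-- The geometric decay of the lengths absorbs any polynomial in the depth and any growth `b ^ k`
slower than it. The case `b = 1` serves summation along paths, `b = 2 ^ γ` the comparison with `d2`.
-/
lemma GoodKeys.exists_le {u : ℕ → unitInterval} (h : GoodKeys u) (p : ℕ) {b δ : ℝ}
    (hb : 0 < b) (hδ : 0 < δ) (hbδ : b * (2 / 3) ^ (δ / 2) < 1) :
    ∃ C : ℝ, 0 < C ∧ ∀ φ : Node,
      ((φ.length : ℝ) + 1) ^ p * b ^ φ.length * len u φ ^ δ ≤ C := by
  -- The real power `δ` of the depth in `len_rpow_le` is rounded up to a natural number.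
  obtain ⟨C, hC0, hC⟩ := exists_pow_mul_pow_le (p + ⌈δ⌉₊) (r := b * (2 / 3) ^ (δ / 2))
    (by positivity) hbδ
  refine ⟨((treeWeight u).toReal ^ (δ / 2) + 1) * C, by positivity, fun φ => ?_⟩
  calc ((φ.length : ℝ) + 1) ^ p * b ^ φ.length * len u φ ^ δ
      ≤ ((φ.length : ℝ) + 1) ^ p * b ^ φ.length * ((treeWeight u).toReal ^ (δ / 2)
        * ((φ.length : ℝ) + 1) ^ (⌈δ⌉₊ : ℝ) * (((2 : ℝ) / 3) ^ (δ / 2)) ^ φ.length) := by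
        gcongr
        refine (h.dense.len_rpow_le h.decay hδ.le φ).trans ?_
        gcongr
        · linarith [(Nat.cast_nonneg φ.length : (0 : ℝ) ≤ φ.length)]
        · exact Nat.le_ceil δ
    _ = (treeWeight u).toReal ^ (δ / 2) * (((φ.length : ℝ) + 1) ^ (p + ⌈δ⌉₊)
        * (b * (2 / 3) ^ (δ / 2)) ^ φ.length) := by
        rw [Real.rpow_natCast, pow_add, mul_pow]; ring
    _ ≤ _ := by
        gcongr
        · linarith
        · exact hC _

lemma GoodKeys.exists_pow_mul_le {u : ℕ → unitInterval} (h : GoodKeys u) (p : ℕ) {δ : ℝ}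
    (hδ : 0 < δ) : ∃ C : ℝ, 0 < C ∧ ∀ φ : Node, ((φ.length : ℝ) + 1) ^ p * len u φ ^ δ ≤ C := by
  obtain ⟨C, hC0, hC⟩ := h.exists_le p one_pos hδ (by
    rw [one_mul]; exact Real.rpow_lt_one (by norm_num) (by norm_num) (by positivity))
  exact ⟨C, hC0, fun φ => by simpa using hC φ⟩

lemma GoodKeys.exists_len_lt {u : ℕ → unitInterval} (h : GoodKeys u) :
    ∀ δ > 0, ∃ k : ℕ, ∀ φ : Node, φ.length = k → len u φ < δ := by
  intro δ hδ
  obtain ⟨C, -, hC⟩ := h.exists_pow_mul_le 1 one_pos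
  obtain ⟨k, hk⟩ := exists_nat_gt (C / δ)
  refine ⟨k, fun φ hφ => ?_⟩
  have h1 := hC φ
  have h2 := h.dense.len_pos φ
  rw [hφ, pow_one, Real.rpow_one] at h1
  rw [div_lt_iff₀ hδ] at hk
  by_contra! hge
  nlinarith [(Nat.cast_nonneg k : (0 : ℝ) ≤ k)]

lemma GoodKeys.exists_split {u : ℕ → unitInterval} (h : GoodKeys u) {α γ : unitInterval}
    (ne : α ≠ γ) : ∃ k, path u α k = path u γ k ∧ path u α (k + 1) ≠ path u γ (k + 1) :=
  Quickselect.exists_split h.dense h.exists_len_lt ne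

lemma DenseKeys.len_path_antitone {u : ℕ → unitInterval} (h : DenseKeys u) (α : unitInterval) :
    Antitone fun k => len u (path u α k) :=
  antitone_nat_of_succ_le fun k => by
    obtain ⟨b, hb⟩ := exists_path_succ u α k
    rw [hb]; exact (h.len_cons_lt b _).le

/-- Along a search path, the sum of the powers of the lengths is controlled by its first term, up
to an arbitrarily small loss in the exponent. -/
lemma GoodKeys.exists_tsum_path_le {u : ℕ → unitInterval} (h : GoodKeys u) {η' η : ℝ}
    (h0 : 0 < η') (hη : η' < η) :
    ∃ C : ℝ, 0 < C ∧ ∀ (α : unitInterval) (k : ℕ),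
      Summable (fun j : ℕ => (((k + j : ℕ) : ℝ) + 1) * len u (path u α (k + j)) ^ η) ∧
      ∑' j : ℕ, (((k + j : ℕ) : ℝ) + 1) * len u (path u α (k + j)) ^ η
        ≤ C * len u (path u α k) ^ η' := by
  -- Of the three powers of the depth, one pays for the factor in the sum and two produce the
  -- summable `(j + 1) ^ (-2)`.
  obtain ⟨C, hC0, hC⟩ := h.exists_pow_mul_le 3 (sub_pos.2 hη)
  have hS0 : 0 < ∑' j : ℕ, (((j : ℝ) + 1) ^ 2)⁻¹ :=
    summable_inv_succ_sq.tsum_pos (fun _ => by positivity) 0 (by positivity)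
  refine ⟨C * ∑' j : ℕ, (((j : ℝ) + 1) ^ 2)⁻¹, by positivity, fun α k => ?_⟩
  have hle : ∀ j : ℕ, (((k + j : ℕ) : ℝ) + 1) * len u (path u α (k + j)) ^ η
      ≤ C * len u (path u α k) ^ η' * (((j : ℝ) + 1) ^ 2)⁻¹ := by
    intro j
    have hp := h.dense.len_pos (path u α (k + j))
    have h1 := hC (path u α (k + j))
    rw [length_path] at h1
    have h2 : len u (path u α (k + j)) ^ η' ≤ len u (path u α k) ^ η' :=
      Real.rpow_le_rpow hp.le (h.dense.len_path_antitone α (Nat.le_add_right k j)) h0.le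
    have e : len u (path u α (k + j)) ^ η
        = len u (path u α (k + j)) ^ (η - η') * len u (path u α (k + j)) ^ η' := by
      rw [← Real.rpow_add hp]; congr 1; ring
    rw [← div_eq_mul_inv, le_div_iff₀ (by positivity)]
    have h3 : ((j : ℝ) + 1) ^ 2 ≤ (((k + j : ℕ) : ℝ) + 1) ^ 2 := by
      push_cast; gcongr; linarith [(Nat.cast_nonneg k : (0 : ℝ) ≤ k)]
    have hl0 : 0 ≤ len u (path u α (k + j)) ^ (η - η') := Real.rpow_nonneg hp.le _
    have hl1 : 0 ≤ len u (path u α (k + j)) ^ η' := Real.rpow_nonneg hp.le _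
    calc (((k + j : ℕ) : ℝ) + 1) * len u (path u α (k + j)) ^ η * ((j : ℝ) + 1) ^ 2
        ≤ (((k + j : ℕ) : ℝ) + 1) * len u (path u α (k + j)) ^ η
          * (((k + j : ℕ) : ℝ) + 1) ^ 2 := by gcongr
      _ = ((((k + j : ℕ) : ℝ) + 1) ^ 3 * len u (path u α (k + j)) ^ (η - η'))
          * len u (path u α (k + j)) ^ η' := by rw [e]; ring
      _ ≤ C * len u (path u α k) ^ η' := by gcongr
  have hs : Summable fun j : ℕ => C * len u (path u α k) ^ η' * (((j : ℝ) + 1) ^ 2)⁻¹ :=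
    summable_inv_succ_sq.mul_left _
  have hnn : ∀ j : ℕ, 0 ≤ (((k + j : ℕ) : ℝ) + 1) * len u (path u α (k + j)) ^ η := fun j =>
    mul_nonneg (by positivity) (Real.rpow_nonneg (h.dense.len_pos _).le _)
  have hs' := Summable.of_nonneg_of_le hnn hle hs
  refine ⟨hs', (hs'.tsum_le_tsum hle hs).trans_eq ?_⟩
  rw [tsum_mul_left]; ring

/-- A function whose oscillation on every node is at most a power of the length of the node is
Hölder continuous with respect to `d2`. -/
lemma GoodKeys.isHolder_d2 {u : ℕ → unitInterval} (h : GoodKeys u) {f : unitInterval → ℝ}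
    {η γ C : ℝ} (hγ : 0 < γ) (hη : γ < η * (1 / 4 * Real.logb 2 (3 / 2)))
    (hf : ∀ α γ k, path u α k = path u γ k → |f α - f γ| ≤ C * len u (path u α k) ^ (η / 2)) :
    IsHolder (d2 u) γ f := by
  have hlog : 0 < Real.logb 2 (3 / 2) := Real.logb_pos (by norm_num) (by norm_num)
  have hη0 : 0 < η := by
    by_contra! hle
    nlinarith
  -- The critical exponent: writing `2/3` as a power of `2`, this says `γ < η / 4 * log₂ (3/2)`.
  have hb : (2 : ℝ) ^ γ * (2 / 3) ^ (η / 2 / 2) < 1 := by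
    have e : ((2 : ℝ) / 3) = 2 ^ (- Real.logb 2 (3 / 2)) := by
      rw [Real.rpow_neg (by norm_num), Real.rpow_logb (by norm_num) (by norm_num) (by norm_num)]
      norm_num
    rw [e, ← Real.rpow_mul (by norm_num), ← Real.rpow_add (by norm_num)]
    exact Real.rpow_lt_one_of_one_lt_of_neg (by norm_num) (by linarith)
  obtain ⟨K, hK0, hK⟩ := h.exists_le 0 (by positivity : (0 : ℝ) < 2 ^ γ) (half_pos hη0) hb
  refine ⟨|C| * K, fun x y => ?_⟩
  rcases eq_or_ne x y with rfl | ne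
  · simp only [sub_self, abs_zero, d2, J_eq_top, if_true, Real.zero_rpow hγ.ne', mul_zero, le_refl]
  · obtain ⟨k, h1, h2⟩ := h.exists_split ne
    have hJ := J_eq_coe h.dense h1 h2
    have e : d2 u x y = ((2 : ℝ) ^ k)⁻¹ := by
      rw [d2, hJ, if_neg (ENat.natCast_ne_top k), ENat.toNat_natCast]
    have h3 := hK (path u x k)
    rw [length_path, pow_zero, one_mul] at h3
    have e2 : ((2 : ℝ) ^ γ) ^ k = ((2 : ℝ) ^ k) ^ γ := by
      rw [← Real.rpow_natCast, ← Real.rpow_mul (by norm_num), mul_comm, Real.rpow_mul (by norm_num),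
        Real.rpow_natCast]
    have hl0 : 0 ≤ len u (path u x k) ^ (η / 2) := Real.rpow_nonneg (h.dense.len_pos _).le _
    calc |f x - f y| ≤ C * len u (path u x k) ^ (η / 2) := hf x y k h1
      _ ≤ |C| * len u (path u x k) ^ (η / 2) := by gcongr; exact le_abs_self C
      _ ≤ |C| * (K * (d2 u x y) ^ γ) := by
          gcongr
          rw [e, Real.inv_rpow (by positivity), ← div_eq_mul_inv, le_div_iff₀ (by positivity),
            ← e2, mul_comm]
          exact h3
      _ = _ := by ring

/-! ### Second moments of tame cost functions on small sets -/

/-- The second moment of `β x` on a set of measure `a` is of order `a ^ θ`, uniformly in `x`. -/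
def MomentBound (β : unitInterval → unitInterval → NNReal) (θ : ℝ) : Prop :=
  ∃ C : ℝ, 0 ≤ C ∧ ∀ (x : unitInterval) (A : Set unitInterval), MeasurableSet A →
    ∫⁻ v in A, (β x v : ENNReal) ^ 2 ≤ ENNReal.ofReal C * volume A ^ θ

lemma momentBound_one : MomentBound (fun _ _ => 1) 1 :=
  ⟨1, zero_le_one, fun x A _ => by simp⟩

/-- The single term with `2 ^ m ≤ b < 2 ^ (m + 1)` already dominates; the summand `1` covers `b <
1`. -/
lemma ENNReal.sq_le_one_add_tsum_dyadic (b : NNReal) :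
    (b : ENNReal) ^ 2 ≤ 1 + ∑' m : ℕ, (4 : ENNReal) ^ (m + 1) *
      {c : NNReal | (2 : NNReal) ^ m ≤ c}.indicator 1 b := by
  rcases le_or_gt 1 b with hb | hb
  · obtain ⟨m, h1, h2⟩ := exists_nat_pow_near hb (one_lt_two)
    refine le_trans ?_ le_add_self
    refine le_trans ?_ (ENNReal.le_tsum m)
    rw [Set.indicator_of_mem (show b ∈ {c : NNReal | (2 : NNReal) ^ m ≤ c} from h1), Pi.one_apply,
      mul_one]
    have : (b : ENNReal) ≤ 2 ^ (m + 1) := by exact_mod_cast h2.le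
    calc (b : ENNReal) ^ 2 ≤ (2 ^ (m + 1)) ^ 2 := by gcongr
      _ = 4 ^ (m + 1) := by rw [← pow_mul, mul_comm, pow_mul]; norm_num
  · refine le_trans ?_ le_self_add
    have : (b : ENNReal) ≤ 1 := by exact_mod_cast hb.le
    exact pow_le_one₀ bot_le this

/-- The part of `A` where `β x ≥ 2 ^ m` has measure at most `|A|` and at most `c 2 ^ (-m/ε)`.
Interpolating with weights `θ` and `1 - θ` leaves the factor `|A| ^ θ` and a series with ratio `4 *
2 ^ (-(1 - θ)/ε)`, which converges exactly for `θ < 1 - 2 ε`. -/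
lemma IsTame.momentBound {ε : ℝ} {β : unitInterval → unitInterval → NNReal}
    (hβ : Measurable (Function.uncurry β)) (h : IsTame ε β) {θ : ℝ} (h0 : 0 ≤ θ)
    (hθ : θ < 1 - 2 * ε) : MomentBound β θ := by
  obtain ⟨hε, c, hc, htail⟩ := h
  have hθ1 : 0 < 1 - θ := by linarith
  set r : ℝ := 4 * (2 : ℝ) ^ (-((1 - θ) / ε)) with hr
  have hr0 : 0 < r := by positivity
  have hr1 : r < 1 := by
    have h4 : (4 : ℝ) = 2 ^ (2 : ℝ) := by norm_num
    rw [hr, h4, ← Real.rpow_add (by norm_num)]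
    apply Real.rpow_lt_one_of_one_lt_of_neg (by norm_num)
    have : 2 < (1 - θ) / ε := by rw [lt_div_iff₀ hε]; linarith
    linarith
  set K : ℝ := 4 * c ^ (1 - θ) * ∑' m : ℕ, r ^ m with hK
  have hsum : Summable fun m : ℕ => 4 * c ^ (1 - θ) * r ^ m :=
    (summable_geometric_of_lt_one hr0.le hr1).mul_left _
  have hK0 : 0 ≤ K := by positivity
  refine ⟨1 + K, by positivity, fun x A hA => ?_⟩
  have hmx : Measurable (β x) := hβ.comp (measurable_const.prodMk measurable_id)
  have hset : ∀ m : ℕ, MeasurableSet {c : NNReal | (2 : NNReal) ^ m ≤ c} := fun m =>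
    measurableSet_Ici
  have hA1 : volume A ≤ volume A ^ θ := by
    calc volume A = volume A ^ (1 : ℝ) := by simp
      _ ≤ _ := ENNReal.rpow_le_rpow_of_exponent_ge prob_le_one (by linarith)
  have hterm : ∀ m : ℕ, (4 : ENNReal) ^ (m + 1) * volume (A ∩ β x ⁻¹' {c | (2 : NNReal) ^ m ≤ c})
      ≤ ENNReal.ofReal (4 * c ^ (1 - θ) * r ^ m) * volume A ^ θ := by
    intro m
    set q := volume (A ∩ β x ⁻¹' {c | (2 : NNReal) ^ m ≤ c}) with hq
    have hq1 : q ≤ volume A := measure_mono Set.inter_subset_left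
    have hq2 : q ≤ ENNReal.ofReal (c * ((2 : ℝ) ^ m) ^ (-(1 / ε))) := by
      refine (measure_mono Set.inter_subset_right).trans ?_
      have := htail x (2 ^ m) Nat.one_le_two_pow
      rw [← ofReal_measureReal]
      apply ENNReal.ofReal_le_ofReal
      push_cast at this
      convert this using 3
      ext v
      simp only [Set.mem_preimage, Set.mem_ofPred_eq]
      rw [← NNReal.coe_le_coe]
      push_cast
      rfl
    have hq3 : q ≤ volume A ^ θ * ENNReal.ofReal (c * ((2 : ℝ) ^ m) ^ (-(1 / ε))) ^ (1 - θ) := by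
      calc q = q ^ θ * q ^ (1 - θ) := by
            rw [← ENNReal.rpow_add_of_nonneg _ _ h0 hθ1.le]; simp
        _ ≤ _ := by gcongr
    calc (4 : ENNReal) ^ (m + 1) * q
        ≤ 4 ^ (m + 1) * (volume A ^ θ *
          ENNReal.ofReal (c * ((2 : ℝ) ^ m) ^ (-(1 / ε))) ^ (1 - θ)) := by gcongr
      _ = (4 ^ (m + 1) * ENNReal.ofReal (c * ((2 : ℝ) ^ m) ^ (-(1 / ε))) ^ (1 - θ))
          * volume A ^ θ := by ring
      _ = _ := by
          congr 1
          have h4 : (4 : ENNReal) = ENNReal.ofReal 4 := by norm_num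
          rw [ENNReal.ofReal_rpow_of_nonneg (by positivity) hθ1.le, h4,
            ← ENNReal.ofReal_pow (by norm_num), ← ENNReal.ofReal_mul (by positivity)]
          congr 1
          have e1 : (((2 : ℝ) ^ m) ^ (-(1 / ε))) ^ (1 - θ) = ((2 : ℝ) ^ (-((1 - θ) / ε))) ^ m := by
            rw [← Real.rpow_natCast 2 m, ← Real.rpow_mul (by norm_num),
              ← Real.rpow_mul (by norm_num), ← Real.rpow_natCast _ m,
              ← Real.rpow_mul (by norm_num)]
            congr 1; ring
          rw [Real.mul_rpow hc.le (by positivity), e1, hr, mul_pow, pow_succ]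
          ring
  calc ∫⁻ v in A, (β x v : ENNReal) ^ 2
      ≤ ∫⁻ v in A, (1 + ∑' m : ℕ, (4 : ENNReal) ^ (m + 1) *
          (β x ⁻¹' {c : NNReal | (2 : NNReal) ^ m ≤ c}).indicator 1 v) :=
        lintegral_mono fun v => ENNReal.sq_le_one_add_tsum_dyadic (β x v)
    _ = volume A + ∑' m : ℕ, (4 : ENNReal) ^ (m + 1) *
          volume (A ∩ β x ⁻¹' {c | (2 : NNReal) ^ m ≤ c}) := by
        have hind : ∀ m : ℕ, Measurable
            ((β x ⁻¹' {c : NNReal | (2 : NNReal) ^ m ≤ c}).indicator (1 : unitInterval → ENNReal)) :=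
          fun m => measurable_one.indicator (hmx (hset m))
        rw [lintegral_add_left measurable_const, lintegral_tsum fun m =>
          ((hind m).const_mul _).aemeasurable]
        congr 1
        · simp
        · refine tsum_congr fun m => ?_
          rw [lintegral_const_mul _ (hind m), lintegral_indicator_one (hmx (hset m)),
            Measure.restrict_apply (hmx (hset m)), Set.inter_comm]
    _ ≤ volume A ^ θ + ∑' m : ℕ, ENNReal.ofReal (4 * c ^ (1 - θ) * r ^ m) * volume A ^ θ :=
        add_le_add hA1 (ENNReal.tsum_le_tsum hterm)
    _ = _ := by
        rw [ENNReal.tsum_mul_right, ← ENNReal.ofReal_tsum_of_nonneg (fun m => by positivity) hsum,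
          tsum_mul_left, ← hK, ENNReal.ofReal_add zero_le_one hK0, ENNReal.ofReal_one, add_mul,
          one_mul]

/-- Triangle inequality for the partial sums, then Fatou's lemma for the norm of the limit. -/
lemma eLpNorm_le_tsum {X : Type*} [MeasurableSpace X] {μ : Measure X} {g : ℕ → X → ℝ}
    {G : X → ℝ} (hg : ∀ k, AEStronglyMeasurable (g k) μ)
    (h : ∀ᵐ v ∂μ, HasSum (fun k => g k v) (G v)) :
    eLpNorm G 2 μ ≤ ∑' k, eLpNorm (g k) 2 μ := by
  have h1 : eLpNorm G 2 μ ≤ atTop.liminf fun n => eLpNorm (fun v => ∑ k ∈ Finset.range n, g k v)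
      2 μ := by
    refine Lp.eLpNorm_lim_le_liminf_eLpNorm (fun n => ?_) G ?_
    · exact Finset.aestronglyMeasurable_fun_sum _ fun k _ => hg k
    · filter_upwards [h] with v hv using hv.tendsto_sum_nat
  refine h1.trans ?_
  have h2 : ∀ n : ℕ, eLpNorm (fun v => ∑ k ∈ Finset.range n, g k v) 2 μ
      ≤ ∑' k, eLpNorm (g k) 2 μ := by
    intro n
    calc eLpNorm (fun v => ∑ k ∈ Finset.range n, g k v) 2 μ
        = eLpNorm (∑ k ∈ Finset.range n, g k) 2 μ := by congr 1; ext v; simp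
      _ ≤ ∑ k ∈ Finset.range n, eLpNorm (g k) 2 μ :=
          eLpNorm_sum_le (fun k _ => hg k) (by norm_num)
      _ ≤ _ := ENNReal.sum_le_tsum _
  exact (liminf_le_liminf (Eventually.of_forall h2)).trans_eq (liminf_const _)

/-! ### The cost of a search path -/

/-- The contribution of the node `φ` to the cost. -/
noncomputable def nodeCost (u : ℕ → unitInterval) (β : unitInterval → unitInterval → NNReal)
    (φ : Node) : unitInterval → ℝ :=
  (Set.Ico (left u φ) (right u φ)).indicator fun w => (β (pivot u φ) w : ℝ)

/-- The total cost along the search path of `α`. -/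
noncomputable def costSum (u : ℕ → unitInterval) (β : unitInterval → unitInterval → NNReal)
    (α v : unitInterval) : ℝ :=
  ∑' k : ℕ, nodeCost u β (path u α k) v

lemma covCost_eq (β : unitInterval → unitInterval → NNReal) (u : ℕ → unitInterval)
    (α γ : unitInterval) :
    covCost β u α γ = cov[costSum u β α, costSum u β γ; (volume : Measure unitInterval)] := rfl

variable {β : unitInterval → unitInterval → NNReal}

lemma measurable_nodeCost (hβ : Measurable (Function.uncurry β)) (φ : Node) :
    Measurable (nodeCost u β φ) := by
  have : Measurable (β (pivot u φ)) := hβ.comp (measurable_const.prodMk measurable_id)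
  exact this.coe_nnreal_real.indicator measurableSet_Ico

lemma eLpNorm_nodeCost_le (h : DenseKeys u) {θ C : ℝ} (h0 : 0 ≤ θ)
    (hC : ∀ (x : unitInterval) (A : Set unitInterval), MeasurableSet A →
      ∫⁻ v in A, (β x v : ENNReal) ^ 2 ≤ ENNReal.ofReal C * volume A ^ θ) (φ : Node) :
    eLpNorm (nodeCost u β φ) 2 volume ≤ ENNReal.ofReal (Real.sqrt C * len u φ ^ (θ / 2)) := by
  have hl := (h.len_pos φ).le
  rw [nodeCost, eLpNorm_indicator_eq_eLpNorm_restrict measurableSet_Ico,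
    eLpNorm_eq_lintegral_rpow_enorm_toReal (by norm_num) (by norm_num)]
  have e : ∀ v : unitInterval, ‖(β (pivot u φ) v : ℝ)‖ₑ ^ ((2 : ENNReal).toReal)
      = (β (pivot u φ) v : ENNReal) ^ 2 := by
    intro v
    rw [ENNReal.toReal_ofNat, ENNReal.rpow_ofNat, Real.enorm_eq_ofReal NNReal.zero_le_coe,
      ENNReal.ofReal_coe_nnreal]
  simp_rw [e]
  calc (∫⁻ v in Set.Ico (left u φ) (right u φ), (β (pivot u φ) v : ENNReal) ^ 2)
        ^ (1 / (2 : ENNReal).toReal)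
      ≤ (ENNReal.ofReal C * volume (Set.Ico (left u φ) (right u φ)) ^ θ)
        ^ (1 / (2 : ENNReal).toReal) := by
        gcongr
        exact hC _ _ measurableSet_Ico
    _ = _ := by
        rw [unitInterval.volume_Ico, ← len, ENNReal.toReal_ofNat,
          ENNReal.mul_rpow_of_nonneg _ _ (by norm_num), ← ENNReal.rpow_mul,
          ENNReal.ofReal_mul (Real.sqrt_nonneg _), ENNReal.ofReal_rpow_of_nonneg hl (by positivity)]
        congr 1
        · rcases le_or_gt 0 C with hC0 | hC0
          · rw [ENNReal.ofReal_rpow_of_nonneg hC0 (by norm_num), Real.sqrt_eq_rpow]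
          · rw [ENNReal.ofReal_of_nonpos hC0.le, Real.sqrt_eq_zero_of_nonpos hC0.le]
            simp
        · congr 2; ring

/-- Off the null set `{α}` the point `v` leaves the search path of `α` at a finite depth, so the
cost series is a finite sum there. -/
lemma GoodKeys.exists_nodeCost_eq_zero (h : GoodKeys u) {α v : unitInterval} (ne : v ≠ α) :
    ∃ K, ∀ k, K ≤ k → ∀ β, nodeCost u β (path u α k) v = 0 := by
  obtain ⟨m, -, hm⟩ := h.exists_split ne
  refine ⟨m + 1, fun k hk β => Set.indicator_of_notMem (fun hv => hm ?_) _⟩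
  have h1 : InNode u (path u α k) v := ⟨hv.1, Or.inl hv.2⟩
  have h2 := h1.path_eq h.dense
  rw [length_path] at h2
  exact path_eq_of_le hk h2

lemma GoodKeys.hasSum_nodeCost (h : GoodKeys u) (β : unitInterval → unitInterval → NNReal)
    {α v : unitInterval} (ne : v ≠ α) :
    HasSum (fun k => nodeCost u β (path u α k) v) (costSum u β α v) := by
  obtain ⟨K, hK⟩ := h.exists_nodeCost_eq_zero ne
  refine Summable.hasSum (summable_of_ne_finset_zero (s := Finset.range K) fun k hk => ?_)
  exact hK k (by simpa using hk) β

lemma GoodKeys.ae_hasSum_nodeCost (h : GoodKeys u) (β : unitInterval → unitInterval → NNReal)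
    (α : unitInterval) :
    ∀ᵐ v, HasSum (fun k => nodeCost u β (path u α k) v) (costSum u β α v) := by
  filter_upwards [compl_mem_ae_iff.2 (measure_singleton α)] with v hv
  exact h.hasSum_nodeCost β hv

lemma GoodKeys.aestronglyMeasurable_costSum (h : GoodKeys u)
    (hβ : Measurable (Function.uncurry β)) (α : unitInterval) :
    AEStronglyMeasurable (costSum u β α) volume := by
  refine aestronglyMeasurable_of_tendsto_ae atTop
    (f := fun (n : ℕ) v => ∑ k ∈ Finset.range n, nodeCost u β (path u α k) v) (fun n => ?_) ?_
  · exact Finset.aestronglyMeasurable_fun_sum _ fun k _ =>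
      (measurable_nodeCost hβ _).aestronglyMeasurable
  · filter_upwards [h.ae_hasSum_nodeCost β α] with v hv using hv.tendsto_sum_nat

lemma GoodKeys.eLpNorm_costSum_sub_le (h : GoodKeys u) (hβ : Measurable (Function.uncurry β))
    {α γ : unitInterval} {k : ℕ} (hk : path u α k = path u γ k) :
    eLpNorm (costSum u β α - costSum u β γ) 2 volume ≤
      ∑' j : ℕ, (eLpNorm (nodeCost u β (path u α (k + j))) 2 volume
        + eLpNorm (nodeCost u β (path u γ (k + j))) 2 volume) := by
  set g : ℕ → unitInterval → ℝ := fun j =>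
    nodeCost u β (path u α j) - nodeCost u β (path u γ j) with hg
  have h1 : eLpNorm (costSum u β α - costSum u β γ) 2 volume ≤ ∑' j, eLpNorm (g j) 2 volume := by
    refine eLpNorm_le_tsum (fun j => ((measurable_nodeCost hβ _).sub
      (measurable_nodeCost hβ _)).aestronglyMeasurable) ?_
    filter_upwards [h.ae_hasSum_nodeCost β α, h.ae_hasSum_nodeCost β γ] with v h1 h2
    exact h1.sub h2
  refine h1.trans ?_
  -- The nodes at levels `j < k` are common to both paths and cancel. Level `k` cancels too, but
  -- keeping it costs only a constant.
  have h2 : ∑ j ∈ Finset.range k, eLpNorm (g j) 2 volume = 0 := by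
    refine Finset.sum_eq_zero fun j hj => ?_
    have : g j = 0 := by
      rw [hg]
      simp only [path_eq_of_le (Finset.mem_range.1 hj).le hk, sub_self]
    rw [this, eLpNorm_zero]
  rw [← ENNReal.summable.sum_add_tsum_nat_add' (k := k), h2, zero_add]
  refine ENNReal.tsum_le_tsum fun j => ?_
  rw [add_comm j k]
  exact eLpNorm_sub_le (measurable_nodeCost hβ _).aestronglyMeasurable
    (measurable_nodeCost hβ _).aestronglyMeasurable (by norm_num)

lemma GoodKeys.eLpNorm_costSum_le (h : GoodKeys u) (hβ : Measurable (Function.uncurry β))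
    (α : unitInterval) :
    eLpNorm (costSum u β α) 2 volume ≤
      ∑' j : ℕ, eLpNorm (nodeCost u β (path u α j)) 2 volume :=
  eLpNorm_le_tsum (fun _ => (measurable_nodeCost hβ _).aestronglyMeasurable)
    (h.ae_hasSum_nodeCost β α)

/-- The variance of the increment between `α` and `γ`. -/
noncomputable def incVar (β : unitInterval → unitInterval → NNReal) (u : ℕ → unitInterval)
    (α γ : unitInterval) : ℝ :=
  Var[costSum u β α - costSum u β γ; (volume : Measure unitInterval)]

/-- Each node contributes an `L²` norm of order `len ^ (θ / 2)`; passing from `θ` to `η` pays for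
summing the rest of the path. -/
lemma GoodKeys.exists_tsum_eLpNorm_nodeCost_le (h : GoodKeys u) {θ η : ℝ}
    (hθ : MomentBound β θ) (h0 : 0 < η) (hη : η < θ) :
    ∃ C : ℝ, 0 < C ∧ ∀ (α : unitInterval) (k : ℕ),
      ∑' j : ℕ, eLpNorm (nodeCost u β (path u α (k + j))) 2 volume
        ≤ ENNReal.ofReal (C * len u (path u α k) ^ (η / 2)) := by
  obtain ⟨K, hK0, hK⟩ := hθ
  obtain ⟨C, hC0, hC⟩ := h.exists_tsum_path_le (half_pos h0) (by linarith : η / 2 < θ / 2)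
  refine ⟨(Real.sqrt K + 1) * C, by positivity, fun α k => ?_⟩
  obtain ⟨h1, h2⟩ := hC α k
  have hnn : ∀ j : ℕ, 0 ≤ (((k + j : ℕ) : ℝ) + 1) * len u (path u α (k + j)) ^ (θ / 2) :=
    fun _ => mul_nonneg (by positivity) (Real.rpow_nonneg (h.dense.len_pos _).le _)
  calc ∑' j : ℕ, eLpNorm (nodeCost u β (path u α (k + j))) 2 volume
      ≤ ∑' j : ℕ, ENNReal.ofReal ((Real.sqrt K + 1) *
          ((((k + j : ℕ) : ℝ) + 1) * len u (path u α (k + j)) ^ (θ / 2))) := by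
        refine ENNReal.tsum_le_tsum fun j => ?_
        refine (eLpNorm_nodeCost_le h.dense (by linarith) hK _).trans ?_
        have hl := Real.rpow_nonneg (h.dense.len_pos (path u α (k + j))).le (θ / 2)
        have : 1 ≤ ((k + j : ℕ) : ℝ) + 1 := by linarith [(Nat.cast_nonneg (k + j) : (0 : ℝ) ≤ _)]
        apply ENNReal.ofReal_le_ofReal
        gcongr
        · linarith
        · exact le_mul_of_one_le_left hl this
    _ = ENNReal.ofReal ((Real.sqrt K + 1) * ∑' j : ℕ,
          ((((k + j : ℕ) : ℝ) + 1) * len u (path u α (k + j)) ^ (θ / 2))) := by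
        rw [← ENNReal.ofReal_tsum_of_nonneg (fun j => mul_nonneg (by positivity) (hnn j))
          (h1.mul_left _), tsum_mul_left]
    _ ≤ _ := by
        apply ENNReal.ofReal_le_ofReal
        rw [mul_assoc]
        gcongr

lemma GoodKeys.memLp_costSum (h : GoodKeys u) (hβ : Measurable (Function.uncurry β)) {θ : ℝ}
    (h0 : 0 < θ) (hθ : MomentBound β θ) (α : unitInterval) :
    MemLp (costSum u β α) 2 volume := by
  obtain ⟨C, hC0, hC⟩ := h.exists_tsum_eLpNorm_nodeCost_le hθ (half_pos h0) (by linarith)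
  refine ⟨h.aestronglyMeasurable_costSum hβ α, ?_⟩
  have := hC α 0
  simp only [zero_add] at this
  exact ((h.eLpNorm_costSum_le hβ α).trans this).trans_lt ENNReal.ofReal_lt_top

lemma variance_le_of_eLpNorm_le {X : Type*} [MeasurableSpace X] {μ : Measure X}
    [IsProbabilityMeasure μ] {f : X → ℝ} (hf : AEStronglyMeasurable f μ) {c : ℝ} (hc : 0 ≤ c)
    (h : eLpNorm f 2 μ ≤ ENNReal.ofReal c) : Var[f; μ] ≤ c ^ 2 := by
  have hL : MemLp f 2 μ := ⟨hf, h.trans_lt ENNReal.ofReal_lt_top⟩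
  refine (variance_le_expectation_sq hf).trans ?_
  have h2 : (eLpNorm f 2 μ).toReal ≤ c := ENNReal.toReal_le_of_le_ofReal hc h
  rw [hL.eLpNorm_eq_integral_rpow_norm (by norm_num) (by norm_num), ENNReal.toReal_ofReal
    (by positivity), ENNReal.toReal_ofNat, ← one_div, ← Real.sqrt_eq_rpow,
    Real.sqrt_le_left hc] at h2
  refine (integral_congr_ae (ae_of_all _ fun v => ?_)).trans_le h2
  simp

lemma GoodKeys.covCost_sub (h : GoodKeys u) (hβ : Measurable (Function.uncurry β)) {θ : ℝ}
    (h0 : 0 < θ) (hθ : MomentBound β θ) (α γ : unitInterval) :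
    covCost β u α α - covCost β u α γ - covCost β u γ α + covCost β u γ γ = incVar β u α γ := by
  have h1 := h.memLp_costSum hβ h0 hθ α
  have h2 := h.memLp_costSum hβ h0 hθ γ
  rw [incVar, ← covariance_self (h1.sub h2).aestronglyMeasurable.aemeasurable,
    covariance_sub_sub h1 h2 h1 h2]
  rfl

lemma GoodKeys.exists_incVar_le (h : GoodKeys u) (hβ : Measurable (Function.uncurry β))
    {θ η : ℝ} (hθ : MomentBound β θ) (h0 : 0 < η) (hη : η < θ) :
    ∃ C : ℝ, 0 < C ∧ ∀ (α γ : unitInterval) (k : ℕ), path u α k = path u γ k →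
      incVar β u α γ ≤ (C * len u (path u α k) ^ (η / 2)) ^ 2 := by
  obtain ⟨C, hC0, hC⟩ := h.exists_tsum_eLpNorm_nodeCost_le hθ h0 hη
  refine ⟨2 * C, by positivity, fun α γ k hk => ?_⟩
  have hl := Real.rpow_nonneg (h.dense.len_pos (path u α k)).le (η / 2)
  refine variance_le_of_eLpNorm_le ((h.aestronglyMeasurable_costSum hβ α).sub
    (h.aestronglyMeasurable_costSum hβ γ)) (by positivity) ?_
  refine (h.eLpNorm_costSum_sub_le hβ hk).trans ?_
  rw [ENNReal.tsum_add]
  refine (add_le_add (hC α k) (hC γ k)).trans_eq ?_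
  rw [← hk, ← ENNReal.ofReal_add (by positivity) (by positivity)]
  congr 1; ring

/-! ### The canonical metric of the limit process for comparisons -/

/-- The cost function that counts comparisons. -/
abbrev unitCost : unitInterval → unitInterval → NNReal := fun _ _ => 1

lemma measurable_unitCost : Measurable (Function.uncurry unitCost) := measurable_const

/-- The half-open interval `[L_φ, R_φ)`. -/
def nodeIco (u : ℕ → unitInterval) (φ : Node) : Set unitInterval := Set.Ico (left u φ) (right u φ)

lemma measurableSet_nodeIco (φ : Node) : MeasurableSet (nodeIco u φ) := measurableSet_Ico

lemma nodeCost_unit (φ : Node) : nodeCost u unitCost φ = (nodeIco u φ).indicator 1 := by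
  ext v; simp [nodeCost, nodeIco, Set.indicator]

lemma DenseKeys.measureReal_nodeIco (h : DenseKeys u) (φ : Node) :
    (volume : Measure unitInterval).real (nodeIco u φ) = len u φ := by
  rw [measureReal_def, nodeIco, unitInterval.volume_Ico, ← len,
    ENNReal.toReal_ofReal (h.len_pos φ).le]

lemma DenseKeys.nodeIco_antitone (h : DenseKeys u) (α : unitInterval) :
    Antitone fun k => nodeIco u (path u α k) := by
  refine antitone_nat_of_succ_le fun k => ?_
  rw [path]
  split_ifs
  · exact Set.Ico_subset_Ico_right (h.pivot_lt_right _).le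
  · exact Set.Ico_subset_Ico_left (h.left_lt_pivot _).le

lemma DenseKeys.path_eq_of_mem_nodeIco (h : DenseKeys u) {v : unitInterval} {φ : Node}
    (hv : v ∈ nodeIco u φ) : path u v φ.length = φ :=
  InNode.path_eq h ⟨hv.1, Or.inl hv.2⟩

lemma DenseKeys.path_eq_path_of_mem (h : DenseKeys u) {v α : unitInterval} {k : ℕ}
    (hv : v ∈ nodeIco u (path u α k)) : path u v k = path u α k := by
  simpa using h.path_eq_of_mem_nodeIco hv

lemma nodeIco_subset_union {α γ : unitInterval} {k : ℕ}
    (e : path u α k = path u γ k) (ne : path u α (k + 1) ≠ path u γ (k + 1)) :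
    nodeIco u (path u α k) ⊆ nodeIco u (path u α (k + 1)) ∪ nodeIco u (path u γ (k + 1)) := by
  intro v hv
  obtain ⟨a, ha⟩ := exists_path_succ u α k
  obtain ⟨b, hb⟩ := exists_path_succ u γ k
  rw [← e] at hb
  rw [ha, hb] at ne ⊢
  have hab : a ≠ b := fun hab => ne (by rw [hab])
  have key : ∀ c, v ∈ nodeIco u (c :: path u α k) ∨ v ∈ nodeIco u ((!c) :: path u α k) := by
    rintro (_ | _)
    · rcases lt_or_ge v (pivot u (path u α k)) with h1 | h1
      · exact Or.inl ⟨hv.1, h1⟩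
      · exact Or.inr ⟨h1, hv.2⟩
    · rcases lt_or_ge v (pivot u (path u α k)) with h1 | h1
      · exact Or.inr ⟨hv.1, h1⟩
      · exact Or.inl ⟨h1, hv.2⟩
  have hb' : b = !a := by
    cases a <;> cases b <;> simp_all
  rw [hb']
  exact key a

lemma nodeCost_unit_nonneg (φ : Node) (v : unitInterval) : 0 ≤ nodeCost u unitCost φ v := by
  rw [nodeCost_unit]; exact Set.indicator_nonneg (fun _ _ => zero_le_one) v

lemma DenseKeys.integral_nodeCost_unit (h : DenseKeys u) (φ : Node) :
    ∫ v, nodeCost u unitCost φ v = len u φ := by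
  simp_rw [nodeCost_unit]
  rw [integral_indicator_one (measurableSet_nodeIco φ), h.measureReal_nodeIco]

lemma integrable_nodeCost_unit (φ : Node) : Integrable (nodeCost u unitCost φ) := by
  rw [nodeCost_unit]
  exact (integrable_const (1 : ℝ)).indicator (measurableSet_nodeIco φ)

/-- The variance of an increment of the cost is bounded below by the length of the interval of the
last common node. -/
lemma GoodKeys.exists_le_incVar (h : GoodKeys u) :
    ∃ c : ℝ, 0 < c ∧ ∀ (α γ : unitInterval) (k : ℕ), path u α k = path u γ k →
      path u α (k + 1) ≠ path u γ (k + 1) → c * len u (path u α k) ≤ incVar unitCost u α γ := by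
  -- Every node below the root misses a set of measure at least `δ`.
  set δ := min (len u [false]) (len u [true]) with hδ
  have hδ0 : 0 < δ := lt_min (h.dense.len_pos _) (h.dense.len_pos _)
  have hδ1 : δ ≤ 1 := (min_le_left _ _).trans (len_le_one _ _)
  have hlen : ∀ (α : unitInterval) (k : ℕ), len u (path u α (k + 1)) ≤ 1 - δ := by
    intro α k
    refine (h.dense.len_path_antitone α (Nat.le_add_left 1 k)).trans ?_
    have h1 := len_false_add_len_true u []
    have h2 : len u [] = 1 := by simp [len]
    obtain ⟨b, hb⟩ := exists_path_succ u α 0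
    change path u α 1 = [b] at hb
    have h3 : δ ≤ len u [false] := min_le_left _ _
    have h4 : δ ≤ len u [true] := min_le_right _ _
    simp only [hb]
    cases b <;> linarith
  refine ⟨δ / 4, by positivity, fun α γ k e ne => ?_⟩
  set D := costSum u unitCost α - costSum u unitCost γ with hD
  have hDL : MemLp D 2 volume :=
    (h.memLp_costSum measurable_unitCost one_pos momentBound_one α).sub
      (h.memLp_costSum measurable_unitCost one_pos momentBound_one γ)
  -- Up to level `k` the costs agree, and outside the child containing `α` the later costs of `α`
  -- vanish.
  have hnonpos : ∀ (α γ v : unitInterval), path u α k = path u γ k → v ≠ α → v ≠ γ →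
      v ∉ nodeIco u (path u α (k + 1)) →
      ∀ j, nodeCost u unitCost (path u α j) v - nodeCost u unitCost (path u γ j) v ≤ 0 := by
    intro α γ v e h1 h2 hv j
    rcases Nat.lt_or_ge k j with hj | hj
    · have : v ∉ nodeIco u (path u α j) := fun hv' => hv (h.dense.nodeIco_antitone α hj hv')
      have h0 : nodeCost u unitCost (path u α j) v = 0 := by
        rw [nodeCost_unit, Set.indicator_of_notMem this]
      rw [h0]
      linarith [nodeCost_unit_nonneg (u := u) (path u γ j) v]
    · rw [path_eq_of_le hj e, sub_self]
  have hae : ∀ᵐ v : unitInterval, v ≠ α ∧ v ≠ γ := by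
    filter_upwards [compl_mem_ae_iff.2 (measure_singleton α),
      compl_mem_ae_iff.2 (measure_singleton γ)] with v h1 h2 using ⟨h1, h2⟩
  have hsum : ∀ (α γ v : unitInterval), v ≠ α → v ≠ γ →
      HasSum (fun j => nodeCost u unitCost (path u α j) v - nodeCost u unitCost (path u γ j) v)
        (costSum u unitCost α v - costSum u unitCost γ v) := fun α γ v h1 h2 =>
    (h.hasSum_nodeCost _ h1).sub (h.hasSum_nodeCost _ h2)
  have hA : ∀ v, v ≠ α → v ≠ γ → v ∉ nodeIco u (path u α (k + 1)) → D v ≤ 0 := by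
    intro v h1 h2 hv
    exact hasSum_le (hnonpos α γ v e h1 h2 hv) (hsum α γ v h1 h2) hasSum_zero
  have hB : ∀ v, v ≠ α → v ≠ γ → v ∉ nodeIco u (path u γ (k + 1)) → 0 ≤ D v := by
    intro v h1 h2 hv
    have := hasSum_le (hnonpos γ α v e.symm h2 h1 hv) (hsum γ α v h2 h1) hasSum_zero
    simp only [hD, Pi.sub_apply]
    linarith
  have hone : ∀ (α γ v : unitInterval), path u α k = path u γ k →
      path u α (k + 1) ≠ path u γ (k + 1) → v ≠ α → v ≠ γ →
      v ∈ nodeIco u (path u α (k + 1)) →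
      1 ≤ costSum u unitCost α v - costSum u unitCost γ v := by
    intro α γ v e ne h1 h2 hv
    have hv' : v ∉ nodeIco u (path u γ (k + 1)) := fun hv' =>
      ne ((h.dense.path_eq_path_of_mem hv).symm.trans (h.dense.path_eq_path_of_mem hv'))
    have hnn : ∀ j, 0 ≤ nodeCost u unitCost (path u α j) v
        - nodeCost u unitCost (path u γ j) v := fun j => by
      linarith [hnonpos γ α v e.symm h2 h1 hv' j]
    have := le_hasSum (hsum α γ v h1 h2) (k + 1) fun j _ => hnn j
    rwa [nodeCost_unit, nodeCost_unit, Set.indicator_of_mem hv, Set.indicator_of_notMem hv',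
      sub_zero] at this
  set m := ∫ v, D v with hm
  have hvar : ∀ E : Set unitInterval, MeasurableSet E →
      (∀ v, v ≠ α → v ≠ γ → v ∈ E → 1 / 2 ≤ |D v - m|) →
      (1 / 4 : ℝ) * (volume : Measure unitInterval).real E ≤ incVar unitCost u α γ := by
    intro E hE hEm
    rw [incVar, variance_eq_integral hDL.aestronglyMeasurable.aemeasurable]
    calc (1 / 4 : ℝ) * (volume : Measure unitInterval).real E
        = ∫ v, E.indicator (fun _ => (1 / 4 : ℝ)) v := by
          rw [integral_indicator_const _ hE, smul_eq_mul, mul_comm]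
      _ ≤ ∫ v, (D v - m) ^ 2 := by
          refine integral_mono_ae ((integrable_const _).indicator hE)
            (hDL.sub (memLp_const m)).integrable_sq ?_
          filter_upwards [hae] with v hv
          by_cases hvE : v ∈ E
          · rw [Set.indicator_of_mem hvE]
            have := hEm v hv.1 hv.2 hvE
            rw [← sq_abs (D v - m)]
            nlinarith
          · rw [Set.indicator_of_notMem hvE]
            exact sq_nonneg _
  have hl1 := len_le_one u (path u α k)
  have hl0 := h.dense.len_pos (path u α k)
  have hcompl : ∀ α : unitInterval,
      δ ≤ (volume : Measure unitInterval).real (nodeIco u (path u α (k + 1)))ᶜ := by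
    intro α
    rw [probReal_compl_eq_one_sub (measurableSet_nodeIco _), h.dense.measureReal_nodeIco]
    linarith [hlen α k]
  -- `D ≤ 0` off the child of `α`, `D ≥ 0` off the child of `γ`, and `|D| ≥ 1` almost everywhere on
  -- the common node. Whatever the mean `m`, `D` therefore deviates from it by `1/2` either on the
  -- complement of a child, of measure at least `δ`, or on the whole common node.
  rcases lt_or_ge (1 / 2) m with hm1 | hm1
  · have := hvar (nodeIco u (path u α (k + 1)))ᶜ (measurableSet_nodeIco _).compl
      fun v h1 h2 hv => by
        have := hA v h1 h2 hv
        rw [abs_of_nonpos (by linarith)]; linarith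
    nlinarith [hcompl α]
  rcases lt_or_ge m (-(1 / 2)) with hm2 | hm2
  · have := hvar (nodeIco u (path u γ (k + 1)))ᶜ (measurableSet_nodeIco _).compl
      fun v h1 h2 hv => by
        have := hB v h1 h2 hv
        rw [abs_of_nonneg (by linarith)]; linarith
    nlinarith [hcompl γ]
  · have := hvar (nodeIco u (path u α k)) (measurableSet_nodeIco _) fun v h1 h2 hv => by
      rcases nodeIco_subset_union e ne hv with hv' | hv'
      · have h3 : 1 ≤ D v := hone α γ v e ne h1 h2 hv'
        rw [abs_of_nonneg (by linarith)]; linarith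
      · have h3 := hone γ α v e.symm ne.symm h2 h1 hv'
        have h4 : D v ≤ -1 := by simp only [hD, Pi.sub_apply]; linarith
        rw [abs_of_nonpos (by linarith)]; linarith
    rw [h.dense.measureReal_nodeIco] at this
    nlinarith

/-- The variance of the increments of the cost of the search path is bounded in terms of the tree
weight. -/
lemma exists_incVar_le_treeWeight : ∃ C : ℝ, 0 < C ∧ ∀ u, GoodKeys u → ∀ α γ : unitInterval,
    incVar unitCost u α γ ≤ C * (1 + (treeWeight u).toReal) := by
  -- The `L²` norm of an indicator is `len ^ (1/2)`, and `len_rpow_le` halves the exponent once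
  -- more.
  have hr0 : (0 : ℝ) < (2 / 3 : ℝ) ^ (1 / 2 / 2 : ℝ) := by positivity
  have hr1 : (2 / 3 : ℝ) ^ (1 / 2 / 2 : ℝ) < 1 :=
    Real.rpow_lt_one (by norm_num) (by norm_num) (by norm_num)
  set r := (2 / 3 : ℝ) ^ (1 / 2 / 2 : ℝ)
  have hs : Summable fun j : ℕ => ((j : ℝ) + 1) * r ^ j := by
    have h1 := summable_pow_mul_geometric_of_norm_lt_one 1
      (by rwa [Real.norm_of_nonneg hr0.le] : ‖r‖ < 1)
    have h2 := summable_geometric_of_lt_one hr0.le hr1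
    refine (h1.add h2).congr fun j => ?_
    ring
  have hK0 : 0 < ∑' j : ℕ, ((j : ℝ) + 1) * r ^ j := hs.tsum_pos (fun j => by positivity) 0 (by simp)
  set K := ∑' j : ℕ, ((j : ℝ) + 1) * r ^ j with hK
  refine ⟨4 * K ^ 2, by positivity, fun u h α γ => ?_⟩
  set W := (treeWeight u).toReal with hW
  have hW0 : 0 ≤ W := ENNReal.toReal_nonneg
  have hnode : ∀ φ : Node, eLpNorm (nodeCost u unitCost φ) 2 volume
      ≤ ENNReal.ofReal (W ^ (1 / 2 / 2 : ℝ) * (((φ.length : ℝ) + 1) * r ^ φ.length)) := by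
    intro φ
    refine (eLpNorm_nodeCost_le h.dense (θ := 1) (C := 1) zero_le_one
      (fun x A _ => by simp) φ).trans ?_
    rw [Real.sqrt_one, one_mul]
    apply ENNReal.ofReal_le_ofReal
    refine (h.dense.len_rpow_le h.decay (by norm_num) φ).trans ?_
    rw [mul_assoc]
    gcongr
    have h1 : 1 ≤ (φ.length : ℝ) + 1 := by linarith [(Nat.cast_nonneg φ.length : (0 : ℝ) ≤ _)]
    calc ((φ.length : ℝ) + 1) ^ (1 / 2 : ℝ) ≤ ((φ.length : ℝ) + 1) ^ (1 : ℝ) :=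
          Real.rpow_le_rpow_of_exponent_le h1 (by norm_num)
      _ = _ := Real.rpow_one _
  have hpath : ∀ α : unitInterval, ∑' j : ℕ, eLpNorm (nodeCost u unitCost (path u α (0 + j))) 2
      volume ≤ ENNReal.ofReal (W ^ (1 / 2 / 2 : ℝ) * K) := by
    intro α
    rw [hK, ← tsum_mul_left, ENNReal.ofReal_tsum_of_nonneg (fun j => by positivity)
      (hs.mul_left _)]
    refine ENNReal.tsum_le_tsum fun j => ?_
    simpa only [length_path, zero_add] using hnode (path u α (0 + j))
  have h1 : incVar unitCost u α γ ≤ (2 * (W ^ (1 / 2 / 2 : ℝ) * K)) ^ 2 := by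
    have hk : path u α 0 = path u γ 0 := rfl
    have hc : 0 ≤ 2 * (W ^ (1 / 2 / 2 : ℝ) * K) := by positivity
    have hle : eLpNorm (costSum u unitCost α - costSum u unitCost γ) 2 volume
        ≤ ENNReal.ofReal (2 * (W ^ (1 / 2 / 2 : ℝ) * K)) := by
      refine (h.eLpNorm_costSum_sub_le measurable_unitCost hk).trans ?_
      rw [ENNReal.tsum_add]
      refine (add_le_add (hpath α) (hpath γ)).trans_eq ?_
      rw [← ENNReal.ofReal_add (by positivity) (by positivity)]
      congr 1; ring
    exact variance_le_of_eLpNorm_le ((h.aestronglyMeasurable_costSum measurable_unitCost α).sub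
      (h.aestronglyMeasurable_costSum measurable_unitCost γ)) hc hle
  refine h1.trans ?_
  have h2 : (W ^ (1 / 2 / 2 : ℝ)) ^ 2 = W ^ (1 / 2 : ℝ) := by
    rw [← Real.rpow_natCast, ← Real.rpow_mul hW0]; norm_num
  -- A bound linear in the tree weight suffices, since the weight has finite expectation.
  have h3 : W ^ (1 / 2 : ℝ) ≤ 1 + W := by
    rw [← Real.sqrt_eq_rpow]
    refine Real.sqrt_le_iff.2 ⟨by positivity, ?_⟩
    nlinarith
  calc (2 * (W ^ (1 / 2 / 2 : ℝ) * K)) ^ 2 = 4 * K ^ 2 * (W ^ (1 / 2 / 2 : ℝ)) ^ 2 := by ring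
    _ ≤ _ := by rw [h2]; gcongr

/-! ### The explicit covariance for comparisons as a covariance of path costs -/

lemma nodeCost_unit_mul (φ ψ : Node) (v : unitInterval) :
    nodeCost u unitCost φ v * nodeCost u unitCost ψ v
      = (nodeIco u φ ∩ nodeIco u ψ).indicator 1 v := by
  rw [nodeCost_unit, nodeCost_unit, Set.inter_indicator_one, Pi.mul_apply]

lemma integral_nodeCost_unit_mul (φ ψ : Node) :
    ∫ v, nodeCost u unitCost φ v * nodeCost u unitCost ψ v
      = (volume : Measure unitInterval).real (nodeIco u φ ∩ nodeIco u ψ) := by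
  simp_rw [nodeCost_unit_mul]
  exact integral_indicator_one ((measurableSet_nodeIco φ).inter (measurableSet_nodeIco ψ))

lemma DenseKeys.measureReal_inter_path (h : DenseKeys u) (α : unitInterval) (j k : ℕ) :
    (volume : Measure unitInterval).real (nodeIco u (path u α k) ∩ nodeIco u (path u α j))
      = len u (path u α (max j k)) := by
  rw [← h.measureReal_nodeIco]
  congr 1
  rcases le_total j k with hjk | hjk
  · rw [max_eq_right hjk, Set.inter_eq_left]; exact h.nodeIco_antitone α hjk
  · rw [max_eq_left hjk, Set.inter_eq_right]; exact h.nodeIco_antitone α hjk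

lemma GoodKeys.summable_len_path (h : GoodKeys u) (α : unitInterval) :
    Summable fun k => len u (path u α k) := by
  obtain ⟨C, -, hC⟩ := h.exists_tsum_path_le one_half_pos one_half_lt_one
  have h1 := (hC α 0).1
  simp only [zero_add, Real.rpow_one] at h1
  refine Summable.of_nonneg_of_le (fun k => (h.dense.len_pos _).le) (fun k => ?_) h1
  exact le_mul_of_one_le_left (h.dense.len_pos _).le
    (by linarith [(Nat.cast_nonneg k : (0 : ℝ) ≤ k)])

lemma GoodKeys.summable_sqrt_len_path (h : GoodKeys u) (α : unitInterval) :
    Summable fun k => Real.sqrt (len u (path u α k)) := by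
  obtain ⟨C, -, hC⟩ := h.exists_tsum_path_le (η' := 1 / 4) (η := 1 / 2) (by norm_num) (by norm_num)
  have h1 := (hC α 0).1
  simp only [zero_add, ← Real.sqrt_eq_rpow] at h1
  refine Summable.of_nonneg_of_le (fun k => Real.sqrt_nonneg _) (fun k => ?_) h1
  exact le_mul_of_one_le_left (Real.sqrt_nonneg _)
    (by linarith [(Nat.cast_nonneg k : (0 : ℝ) ≤ k)])

lemma GoodKeys.integral_costSum_unit (h : GoodKeys u) (α : unitInterval) :
    ∫ v, costSum u unitCost α v = S u α := by
  have h1 := hasSum_integral_of_summable_integral_norm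
    (F := fun k v => nodeCost u unitCost (path u α k) v) (μ := volume)
    (fun k => integrable_nodeCost_unit _) (by
      simp_rw [Real.norm_of_nonneg (nodeCost_unit_nonneg _ _), h.dense.integral_nodeCost_unit]
      exact h.summable_len_path α)
  simp_rw [h.dense.integral_nodeCost_unit] at h1
  exact h1.tsum_eq.symm

lemma memLp_nodeCost_unit (φ : Node) : MemLp (nodeCost u unitCost φ) 2 volume := by
  rw [nodeCost_unit]
  exact (memLp_const (1 : ℝ)).indicator (measurableSet_nodeIco φ)

lemma GoodKeys.memLp_costSum_unit (h : GoodKeys u) (α : unitInterval) :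
    MemLp (costSum u unitCost α) 2 volume :=
  h.memLp_costSum measurable_unitCost one_pos momentBound_one α

/-- The mean of the product of the cost of `α` with the indicator of a node. -/
lemma GoodKeys.hasSum_integral_nodeCost_mul_costSum (h : GoodKeys u) (α : unitInterval)
    (φ : Node) :
    HasSum (fun j => (volume : Measure unitInterval).real
      (nodeIco u φ ∩ nodeIco u (path u α j)))
      (∫ v, nodeCost u unitCost φ v * costSum u unitCost α v) := by
  have h1 := hasSum_integral_of_summable_integral_norm
    (F := fun k v => nodeCost u unitCost φ v * nodeCost u unitCost (path u α k) v) (μ := volume)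
    (fun k => (memLp_nodeCost_unit _).integrable_mul (memLp_nodeCost_unit _)) (by
      simp_rw [Real.norm_of_nonneg (mul_nonneg (nodeCost_unit_nonneg _ _)
        (nodeCost_unit_nonneg _ _)), integral_nodeCost_unit_mul]
      refine Summable.of_nonneg_of_le (fun k => measureReal_nonneg) (fun k => ?_)
        (h.summable_len_path α)
      rw [← h.dense.measureReal_nodeIco]
      exact measureReal_mono Set.inter_subset_right)
  simp_rw [integral_nodeCost_unit_mul, tsum_mul_left] at h1
  exact h1

/-- Sum and integral may be interchanged because, by Cauchy-Schwarz, the `k`-th term is at most the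
square root of a length times a fixed `L²` norm, and these square roots are summable. -/
lemma GoodKeys.hasSum_integral_costSum_mul (h : GoodKeys u) (α γ : unitInterval) :
    HasSum (fun k => ∫ v, nodeCost u unitCost (path u γ k) v * costSum u unitCost α v)
      (∫ v, costSum u unitCost γ v * costSum u unitCost α v) := by
  have h1 := hasSum_integral_of_summable_integral_norm
    (F := fun k v => nodeCost u unitCost (path u γ k) v * costSum u unitCost α v) (μ := volume)
    (fun k => (memLp_nodeCost_unit _).integrable_mul (h.memLp_costSum_unit α)) (by
      refine Summable.of_nonneg_of_le (fun k => integral_nonneg fun v => norm_nonneg _)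
        (fun k => ?_) ((h.summable_sqrt_len_path γ).mul_right
          ((∫ v, ‖costSum u unitCost α v‖ ^ (2 : ℝ)) ^ (1 / 2 : ℝ)))
      simp_rw [norm_mul]
      have h2 : ENNReal.ofReal 2 = 2 := by norm_num
      refine (integral_mul_norm_le_Lp_mul_Lq (p := 2) (q := 2) Real.HolderConjugate.two_two
        (by rw [h2]; exact memLp_nodeCost_unit _)
        (by rw [h2]; exact h.memLp_costSum_unit α)).trans_eq ?_
      congr 1
      rw [Real.sqrt_eq_rpow, ← h.dense.integral_nodeCost_unit]
      congr 2
      ext v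
      rw [nodeCost_unit]
      by_cases hv : v ∈ nodeIco u (path u γ k) <;> simp [hv])
  simp_rw [tsum_mul_right] at h1
  exact h1

-- Intervals on the two paths are nested or disjoint. For `k ≤ J` the node of `γ` is also on the
-- path of `α` and meets its `j`-th node in the node of depth `max j k`. For `k > J` the node of `γ`
-- meets only the `J + 1` common nodes, each in its full length.
open Classical in
lemma GoodKeys.integral_costSum_mul (h : GoodKeys u) (α γ : unitInterval) :
    ∫ v, costSum u unitCost γ v * costSum u unitCost α v =
      (∑' k : ℕ, if (k : ℕ∞) ≤ J u α γ then ∑' j : ℕ, len u (path u α (max j k)) else 0)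
      + (if α ≠ γ then
          (((J u α γ).toNat : ℝ) + 1) * ∑' j : ℕ, len u (path u γ ((J u α γ).toNat + 1 + j))
        else 0) := by
  have h1 := h.hasSum_integral_costSum_mul α γ
  have hcommon : ∀ k, path u α k = path u γ k →
      ∫ v, nodeCost u unitCost (path u γ k) v * costSum u unitCost α v
        = ∑' j : ℕ, len u (path u α (max j k)) := by
    intro k hk
    have := (h.hasSum_integral_nodeCost_mul_costSum α (path u γ k)).tsum_eq
    rw [← this, ← hk]
    simp_rw [h.dense.measureReal_inter_path]
  rcases eq_or_ne α γ with rfl | ne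
  · rw [if_neg (not_not.2 rfl), add_zero, ← h1.tsum_eq, J_eq_top]
    refine tsum_congr fun k => ?_
    rw [if_pos le_top, hcommon k rfl]
  · obtain ⟨m, h2, h3⟩ := h.exists_split ne
    rw [if_pos ne, J_eq_coe h.dense h2 h3, ENat.toNat_natCast, ← h1.tsum_eq,
      ← h1.summable.sum_add_tsum_nat_add (m + 1)]
    congr 1
    · rw [tsum_eq_sum (s := Finset.range (m + 1))]
      · refine Finset.sum_congr rfl fun k hk => ?_
        have hk' : k ≤ m := Nat.lt_succ_iff.1 (Finset.mem_range.1 hk)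
        rw [if_pos (by exact_mod_cast hk'), hcommon k (path_eq_of_le hk' h2)]
      · intro k hk
        rw [Finset.mem_range, not_lt] at hk
        exact if_neg (by norm_cast; omega)
    · rw [← tsum_mul_left]
      refine tsum_congr fun k => ?_
      have h4 := (h.hasSum_integral_nodeCost_mul_costSum α (path u γ (k + (m + 1)))).tsum_eq
      rw [← h4, tsum_eq_sum (s := Finset.range (m + 1))]
      · rw [Finset.sum_congr rfl (g := fun _ => len u (path u γ (m + 1 + k))) fun j hj => ?_]
        · simp
        · have hj' : j ≤ m := Nat.lt_succ_iff.1 (Finset.mem_range.1 hj)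
          rw [path_eq_of_le hj' h2, h.dense.measureReal_inter_path, max_eq_right (by omega),
            add_comm]
      · intro j hj
        rw [Finset.mem_range, not_lt] at hj
        -- A common point would have a search path agreeing with both paths at depth `m + 1`, beyond
        -- the split.
        have : nodeIco u (path u γ (k + (m + 1))) ∩ nodeIco u (path u α j) = ∅ := by
          rw [Set.eq_empty_iff_forall_notMem]
          rintro v ⟨hv1, hv2⟩
          have e1 := path_eq_of_le (by omega : m + 1 ≤ k + (m + 1))
            (h.dense.path_eq_path_of_mem hv1)
          have e2 := path_eq_of_le hj (h.dense.path_eq_path_of_mem hv2)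
          exact h3 (e2.symm.trans e1)
        rw [this, measureReal_empty]

/-- Comparisons thereby become the case `β = 1`, so one argument treats both limit processes. -/
lemma GoodKeys.covComp_eq (h : GoodKeys u) (α γ : unitInterval) :
    covComp u α γ = covCost unitCost u α γ := by
  rw [covCost_eq, covariance_eq_sub (h.memLp_costSum_unit α) (h.memLp_costSum_unit γ),
    h.integral_costSum_unit, h.integral_costSum_unit, covComp, ← h.integral_costSum_mul]
  congr 1
  refine integral_congr_ae (ae_of_all _ fun v => ?_)
  exact mul_comm _ _

lemma incVar_nonneg (β : unitInterval → unitInterval → NNReal) (u : ℕ → unitInterval)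
    (α γ : unitInterval) : 0 ≤ incVar β u α γ := variance_nonneg _ _

lemma GoodKeys.dG_sq (h : GoodKeys u) (α γ : unitInterval) :
    dG u α γ ^ 2 = incVar unitCost u α γ := by
  have h1 := h.covCost_sub measurable_unitCost one_pos momentBound_one α γ
  have h2 : covCost unitCost u γ α = covCost unitCost u α γ := covariance_comm _ _
  have h3 : covComp u α α - 2 * covComp u α γ + covComp u γ γ = incVar unitCost u α γ := by
    rw [← h1, h.covComp_eq, h.covComp_eq, h.covComp_eq, h2]; ring
  rw [dG, h3, Real.sq_sqrt (incVar_nonneg _ _ _ _)]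

/-- A function whose oscillation on every node is at most a power of the length of the node is
Hölder continuous with respect to `dG`. -/
lemma GoodKeys.isHolder_dG (h : GoodKeys u) {f : unitInterval → ℝ}
    {η C : ℝ} (hη : 0 < η)
    (hf : ∀ α γ k, path u α k = path u γ k → |f α - f γ| ≤ C * len u (path u α k) ^ (η / 2)) :
    IsHolder (dG u) η f := by
  obtain ⟨c, hc0, hc⟩ := h.exists_le_incVar
  refine ⟨|C| * (c⁻¹) ^ (η / 2), fun x y => ?_⟩
  have hd : 0 ≤ dG u x y := Real.sqrt_nonneg _
  rcases eq_or_ne x y with rfl | ne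
  · rw [sub_self, abs_zero]; positivity
  · obtain ⟨k, h1, h2⟩ := h.exists_split ne
    have h3 := hc x y k h1 h2
    rw [← h.dG_sq] at h3
    have hl0 := (h.dense.len_pos (path u x k)).le
    calc |f x - f y| ≤ C * len u (path u x k) ^ (η / 2) := hf x y k h1
      _ ≤ |C| * len u (path u x k) ^ (η / 2) := by gcongr; exact le_abs_self C
      -- The lower bound on the variance of the increment, read as an upper bound for the length.
      _ ≤ |C| * (c⁻¹ * dG u x y ^ 2) ^ (η / 2) := by
          gcongr
          rwa [inv_mul_eq_div, le_div_iff₀ hc0, mul_comm]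
      _ = _ := by
          rw [Real.mul_rpow (by positivity) (by positivity), ← Real.rpow_natCast,
            ← Real.rpow_mul hd, mul_assoc]
          congr 3
          push_cast; ring

/-! ### Conditionally Gaussian random variables -/

lemma gaussianReal_tail_le (v : NNReal) {s : ℝ} (hs : 0 ≤ s) :
    gaussianReal 0 v {x | s * Real.sqrt v < |x|} ≤ ENNReal.ofReal (2 * Real.exp (-s ^ 2 / 2)) := by
  -- For variance zero the strict inequality in the event makes it null.
  rcases eq_or_ne v 0 with rfl | hv
  · rw [gaussianReal_zero_var, Measure.dirac_apply]
    simp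
  have hv' : (0 : ℝ) < v := by exact_mod_cast pos_iff_ne_zero.2 hv
  have hg : ∀ ε : ℝ, 0 ≤ ε → (gaussianReal 0 v).real (Set.Ici ε) ≤ Real.exp (-ε ^ 2 / (2 * v)) := by
    have h : HasSubgaussianMGF id v (gaussianReal 0 v) :=
      ⟨fun t => integrable_exp_mul_gaussianReal t, fun t => by rw [mgf_id_gaussianReal]; simp⟩
    exact fun ε hε => h.measure_ge_le hε
  have hneg : ∀ ε : ℝ, (gaussianReal 0 v).real (Set.Iic (-ε)) =
      (gaussianReal 0 v).real (Set.Ici ε) := by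
    intro ε
    have h1 : gaussianReal 0 v = (gaussianReal 0 v).map (fun x => -x) := by
      rw [gaussianReal_map_neg, neg_zero]
    conv_rhs => rw [h1]
    rw [map_measureReal_apply measurable_neg measurableSet_Ici]
    congr 1
    ext x
    exact (le_neg : x ≤ -ε ↔ ε ≤ -x)
  have hsub : {x | s * Real.sqrt v < |x|} ⊆
      Set.Iic (-(s * Real.sqrt v)) ∪ Set.Ici (s * Real.sqrt v) := by
    intro x hx
    rcases lt_abs.1 (show s * Real.sqrt v < |x| from hx) with h | h
    · exact Or.inr h.le
    · exact Or.inl (show x ≤ -(s * Real.sqrt v) by linarith)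
  have hb := hg (s * Real.sqrt v) (by positivity)
  have he : -(s * Real.sqrt v) ^ 2 / (2 * v) = -s ^ 2 / 2 := by
    rw [mul_pow, Real.sq_sqrt hv'.le]; field_simp
  rw [he] at hb
  refine (measure_mono hsub).trans ((measure_union_le _ _).trans ?_)
  rw [← ofReal_measureReal, ← ofReal_measureReal, hneg, ← ENNReal.ofReal_add (by positivity)
    (by positivity)]
  exact ENNReal.ofReal_le_ofReal (by linarith)

lemma lintegral_sq_gaussianReal (v : NNReal) :
    ∫⁻ x, ENNReal.ofReal (x ^ 2) ∂(gaussianReal 0 v) = v := by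
  have h := variance_id_gaussianReal (μ := 0) (v := v)
  rw [variance_eq_integral measurable_id.aemeasurable] at h
  simp only [id_eq, integral_id_gaussianReal, sub_zero] at h
  rw [← ofReal_integral_eq_lintegral_ofReal, h, ENNReal.ofReal_coe_nnreal]
  · exact (memLp_id_gaussianReal 2).integrable_sq
  · exact ae_of_all _ fun x => sq_nonneg x

section CondLaw

variable {Ω T : Type*} {mΩ : MeasurableSpace Ω} {mT : MeasurableSpace T} {P : Measure Ω}
  [IsProbabilityMeasure P] {p : Ω → T} {X : Ω → ℝ} {v : Ω → ℝ}

/-- The regular conditional law of a conditionally Gaussian random variable. -/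
lemma ae_condDistrib_eq_gaussianReal (hp : Measurable p) (hX : Measurable X)
    (hlaw : ∀ B : Set ℝ, MeasurableSet B → P⟦{ω | X ω ∈ B} | mT.comap p⟧ =ᵐ[P]
      fun ω => (gaussianReal 0 (v ω).toNNReal).real B) :
    ∀ᵐ ω ∂P, condDistrib X p P (p ω) = gaussianReal 0 (v ω).toNNReal := by
  -- Rational intervals determine a law on the line, and being countably many they leave a single
  -- null set.
  have h : ∀ᵐ ω ∂P, ∀ a b : ℚ, (condDistrib X p P (p ω)).real (Set.Ioo (a : ℝ) b)
      = (gaussianReal 0 (v ω).toNNReal).real (Set.Ioo (a : ℝ) b) := by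
    rw [ae_all_iff]; intro a
    rw [ae_all_iff]; intro b
    exact (condDistrib_ae_eq_condExp hp hX measurableSet_Ioo).trans (hlaw _ measurableSet_Ioo)
  filter_upwards [h] with ω hω
  exact Real.measure_ext_Ioo_rat fun a b => by
    rw [← ofReal_measureReal, ← ofReal_measureReal, hω a b]

/-- The variance `v` carries no measurability assumption; its positive part is recovered here as a
measurable function of `p`. -/
lemma ae_lintegral_sq_condDistrib (hp : Measurable p) (hX : Measurable X)
    (hlaw : ∀ B : Set ℝ, MeasurableSet B → P⟦{ω | X ω ∈ B} | mT.comap p⟧ =ᵐ[P]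
      fun ω => (gaussianReal 0 (v ω).toNNReal).real B) :
    ∀ᵐ ω ∂P, ∫⁻ x, ENNReal.ofReal (x ^ 2) ∂(condDistrib X p P (p ω)) = ENNReal.ofReal (v ω) := by
  filter_upwards [ae_condDistrib_eq_gaussianReal hp hX hlaw] with ω hω
  rw [hω, lintegral_sq_gaussianReal]; rfl

/-- The Gaussian tail bound is integrated against the conditional law. The event `E` localizes it,
so that later it can be applied at points depending on the conditioning. -/
lemma measure_inter_tail_le (hp : Measurable p) (hX : Measurable X)
    (hlaw : ∀ B : Set ℝ, MeasurableSet B → P⟦{ω | X ω ∈ B} | mT.comap p⟧ =ᵐ[P]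
      fun ω => (gaussianReal 0 (v ω).toNNReal).real B) {s : ℝ} (hs : 0 ≤ s) {E : Set T}
    (hE : MeasurableSet E) :
    P ({ω | s * Real.sqrt (v ω) < |X ω|} ∩ p ⁻¹' E)
      ≤ ENNReal.ofReal (2 * Real.exp (-s ^ 2 / 2)) * P (p ⁻¹' E) := by
  set κ := condDistrib X p P with hκ
  set w : T → ENNReal := fun t => ∫⁻ x, ENNReal.ofReal (x ^ 2) ∂(κ t) with hw
  have hwm : Measurable w := Measurable.lintegral_kernel (by fun_prop)
  set B : Set (T × ℝ) := {q | s * Real.sqrt (w q.1).toReal < |q.2|} ∩ (Prod.fst ⁻¹' E) with hB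
  have hBm : MeasurableSet B := by
    refine MeasurableSet.inter (measurableSet_lt ?_ ?_) (measurable_fst hE)
    · exact ((hwm.comp measurable_fst).ennreal_toReal.sqrt).const_mul s
    · exact measurable_snd.abs
  have hae : ∀ᵐ ω ∂P, κ (p ω) = gaussianReal 0 (v ω).toNNReal ∧
      Real.sqrt (w (p ω)).toReal = Real.sqrt (v ω) ∧
      Real.sqrt (v ω) = Real.sqrt ((v ω).toNNReal : ℝ) := by
    filter_upwards [ae_condDistrib_eq_gaussianReal hp hX hlaw,
      ae_lintegral_sq_condDistrib hp hX hlaw] with ω h1 h2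
    have h3 : Real.sqrt (v ω) = Real.sqrt ((v ω).toNNReal : ℝ) := by
      rcases le_total 0 (v ω) with h0 | h0
      · rw [Real.coe_toNNReal _ h0]
      · rw [Real.toNNReal_of_nonpos h0, Real.sqrt_eq_zero_of_nonpos h0]; simp
    refine ⟨h1, ?_, h3⟩
    rw [h3, hw]
    simp only
    rw [h2]
    rfl
  calc P ({ω | s * Real.sqrt (v ω) < |X ω|} ∩ p ⁻¹' E)
      = P ((fun ω => (p ω, X ω)) ⁻¹' B) := by
        refine measure_congr ?_
        filter_upwards [hae] with ω hω
        apply propext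
        change (s * Real.sqrt (v ω) < |X ω| ∧ p ω ∈ E)
          ↔ (s * Real.sqrt (w (p ω)).toReal < |X ω| ∧ p ω ∈ E)
        rw [hω.2.1]
    _ = ((P.map p) ⊗ₘ κ) B := by
        rw [← Measure.map_apply (hp.prodMk hX) hBm, hκ, compProd_map_condDistrib hX.aemeasurable]
    _ = ∫⁻ ω, κ (p ω) (Prod.mk (p ω) ⁻¹' B) ∂P := by
        rw [Measure.compProd_apply hBm, lintegral_map (Kernel.measurable_kernel_prodMk_left hBm) hp]
    _ ≤ ∫⁻ ω, (p ⁻¹' E).indicator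
          (fun _ => ENNReal.ofReal (2 * Real.exp (-s ^ 2 / 2))) ω ∂P := by
        refine lintegral_mono_ae ?_
        filter_upwards [hae] with ω hω
        by_cases hωE : p ω ∈ E
        · rw [Set.indicator_of_mem (show ω ∈ p ⁻¹' E from hωE), hω.1]
          refine le_trans (measure_mono ?_) (gaussianReal_tail_le _ hs)
          intro x hx
          have : s * Real.sqrt (w (p ω)).toReal < |x| := hx.1
          rwa [hω.2.1, hω.2.2] at this
        · have : Prod.mk (p ω) ⁻¹' B = ∅ := by
            ext x
            simp [hB, hωE]
          rw [this, measure_empty]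
          exact bot_le
    _ = _ := by rw [lintegral_indicator_const (hp hE)]

lemma condExp_sq_ae_eq (hp : Measurable p) (hX : Measurable X)
    (hlaw : ∀ B : Set ℝ, MeasurableSet B → P⟦{ω | X ω ∈ B} | mT.comap p⟧ =ᵐ[P]
      fun ω => (gaussianReal 0 (v ω).toNNReal).real B) (hv : ∀ᵐ ω ∂P, 0 ≤ v ω)
    (hint : ∫⁻ ω, ENNReal.ofReal (v ω) ∂P ≠ ⊤) :
    P[fun ω => X ω ^ 2 | mT.comap p] =ᵐ[P] v := by
  have hsq : Measurable fun x : ℝ => ENNReal.ofReal (x ^ 2) := by fun_prop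
  have hsq2 : Measurable fun q : T × ℝ => ENNReal.ofReal (q.2 ^ 2) := by fun_prop
  have h1 : ∫⁻ ω, ENNReal.ofReal (X ω ^ 2) ∂P = ∫⁻ ω, ENNReal.ofReal (v ω) ∂P := by
    calc ∫⁻ ω, ENNReal.ofReal (X ω ^ 2) ∂P
        = ∫⁻ q : T × ℝ, ENNReal.ofReal (q.2 ^ 2) ∂(P.map fun ω => (p ω, X ω)) := by
          rw [lintegral_map hsq2 (hp.prodMk hX)]
      _ = ∫⁻ ω, ∫⁻ x, ENNReal.ofReal (x ^ 2) ∂(condDistrib X p P (p ω)) ∂P := by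
          rw [← compProd_map_condDistrib hX.aemeasurable,
            Measure.lintegral_compProd hsq2,
            lintegral_map (Measurable.lintegral_kernel hsq) hp]
      _ = _ := lintegral_congr_ae (ae_lintegral_sq_condDistrib hp hX hlaw)
  have hintX : Integrable (fun ω => X ω ^ 2) P := by
    refine ⟨(hX.pow_const 2).aestronglyMeasurable, ?_⟩
    rw [hasFiniteIntegral_iff_ofReal (ae_of_all _ fun ω => sq_nonneg _), h1]
    exact hint.lt_top
  refine (condExp_ae_eq_integral_condDistrib hp hX.aemeasurable (f := fun x => x ^ 2)
    (by fun_prop) hintX).trans ?_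
  filter_upwards [ae_lintegral_sq_condDistrib hp hX hlaw, hv] with ω hω h0
  rw [integral_eq_lintegral_of_nonneg_ae (ae_of_all _ fun x => sq_nonneg x)
    (by fun_prop), hω, ENNReal.toReal_ofReal h0]

end CondLaw

section Mixed

variable {Ω T : Type*} {F mΩ : MeasurableSpace Ω} {P : Measure Ω}
  {X : T → Ω → ℝ} {C : Ω → T → T → ℝ}

lemma IsMixedCentredGaussian.condLaw_single (h : IsMixedCentredGaussian F P X C) (t : T) :
    ∀ B : Set ℝ, MeasurableSet B → P⟦{ω | X t ω ∈ B} | F⟧ =ᵐ[P]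
      fun ω => (gaussianReal 0 (C ω t t).toNNReal).real B := by
  intro B hB
  have := h.cond_law {t} (fun _ => 1) B hB
  simpa using this

lemma IsMixedCentredGaussian.condLaw_sub (h : IsMixedCentredGaussian F P X C) {s t : T}
    (hst : s ≠ t) :
    ∀ B : Set ℝ, MeasurableSet B → P⟦{ω | X s ω - X t ω ∈ B} | F⟧ =ᵐ[P]
      fun ω => (gaussianReal 0 (C ω s s - C ω s t - C ω t s + C ω t t).toNNReal).real B := by
  classical
  intro B hB
  -- Distinctness of `s` and `t` is essential here: otherwise the index set collapses to one
  -- element.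
  have := h.cond_law {s, t} (fun r => if r = s then 1 else -1) B hB
  simp only [Finset.sum_pair hst, if_true, if_neg hst.symm, one_mul, neg_mul, mul_neg,
    neg_neg] at this
  have e1 : ∀ ω, X s ω + -X t ω = X s ω - X t ω := fun ω => by ring
  have e2 : ∀ ω, C ω s s + -C ω s t + (-C ω t s + C ω t t)
      = C ω s s - C ω s t - C ω t s + C ω t t := fun ω => by ring
  simpa only [e1, e2] using this

lemma IsMixedCentredGaussian.congr {C' : Ω → T → T → ℝ} (h : IsMixedCentredGaussian F P X C)
    (hC : ∀ᵐ ω ∂P, ∀ s t, C ω s t = C' ω s t) : IsMixedCentredGaussian F P X C' where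
  measurable := h.measurable
  cond_law A a B hB := by
    refine (h.cond_law A a B hB).trans ?_
    filter_upwards [hC] with ω hω
    simp only [hω]

/-- A sub-σ-algebra is generated by the identity map into `Ω` equipped with it. -/
lemma measure_inter_tail_le_of_le [IsProbabilityMeasure P] (hF : F ≤ mΩ) {X : Ω → ℝ} {v : Ω → ℝ}
    (hX : Measurable[mΩ] X)
    (hlaw : ∀ B : Set ℝ, MeasurableSet B → P⟦{ω | X ω ∈ B} | F⟧ =ᵐ[P]
      fun ω => (gaussianReal 0 (v ω).toNNReal).real B) {s : ℝ} (hs : 0 ≤ s) {E : Set Ω}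
    (hE : MeasurableSet[F] E) :
    P ({ω | s * Real.sqrt (v ω) < |X ω|} ∩ E)
      ≤ ENNReal.ofReal (2 * Real.exp (-s ^ 2 / 2)) * P E := by
  have hid : @Measurable Ω Ω mΩ F id := measurable_id'' hF
  rw [← MeasurableSpace.comap_id (m := F)] at hlaw
  exact measure_inter_tail_le (mT := F) hid hX hlaw hs hE

lemma condExp_sq_ae_eq_of_le [IsProbabilityMeasure P] (hF : F ≤ mΩ) {X : Ω → ℝ} {v : Ω → ℝ}
    (hX : Measurable[mΩ] X)
    (hlaw : ∀ B : Set ℝ, MeasurableSet B → P⟦{ω | X ω ∈ B} | F⟧ =ᵐ[P]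
      fun ω => (gaussianReal 0 (v ω).toNNReal).real B) (hv : ∀ᵐ ω ∂P, 0 ≤ v ω)
    (hint : ∫⁻ ω, ENNReal.ofReal (v ω) ∂P ≠ ⊤) :
    P[fun ω => X ω ^ 2 | F] =ᵐ[P] v := by
  have hid : @Measurable Ω Ω mΩ F id := measurable_id'' hF
  rw [← MeasurableSpace.comap_id (m := F)] at hlaw
  have := condExp_sq_ae_eq (mT := F) hid hX hlaw hv hint
  rwa [MeasurableSpace.comap_id] at this

end Mixed

/-! ### Chaining along the tree -/

/-- A dense sequence of points whose first element is `1`. -/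
noncomputable def densePoint : ℕ → unitInterval
  | 0 => 1
  | n + 1 => TopologicalSpace.denseSeq unitInterval n

lemma exists_densePoint_between {l r : unitInterval} (h : l < r) :
    ∃ i, l < densePoint i ∧ densePoint i < r := by
  obtain ⟨x, ⟨i, rfl⟩, h1, h2⟩ := (TopologicalSpace.denseRange_denseSeq unitInterval).exists_between h
  exact ⟨i + 1, h1, h2⟩

/-- The index of the first point of the dense sequence in the node `φ`. -/
noncomputable def repIdx (u : ℕ → unitInterval) (φ : Node) : ℕ :=
  sInf {i | path u (densePoint i) φ.length = φ}

/-- A representative of the node `φ`. -/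
noncomputable def rep (u : ℕ → unitInterval) (φ : Node) : unitInterval := densePoint (repIdx u φ)

lemma DenseKeys.path_rep (h : DenseKeys u) (φ : Node) : path u (rep u φ) φ.length = φ := by
  refine Nat.sInf_mem (s := {i | path u (densePoint i) φ.length = φ}) ?_
  obtain ⟨i, h1, h2⟩ := exists_densePoint_between (h.left_lt_right φ)
  exact ⟨i, InNode.path_eq h ⟨h1.le, Or.inl h2⟩⟩

/-- The representative has index at most `i`, and the finitely many earlier points distinct from
`densePoint i` are separated from it at some depth. Chains ending at a dense point are therefore
finite. -/
lemma GoodKeys.exists_rep_path_eq (h : GoodKeys u) (i : ℕ) :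
    ∃ M, ∀ m, M ≤ m → rep u (path u (densePoint i) m) = densePoint i := by
  have hsep : ∀ j, ∃ M, ∀ m, M ≤ m → path u (densePoint j) m = path u (densePoint i) m →
      densePoint j = densePoint i := by
    intro j
    rcases eq_or_ne (densePoint j) (densePoint i) with e | ne
    · exact ⟨0, fun _ _ _ => e⟩
    · obtain ⟨k, -, hk⟩ := h.exists_split ne
      exact ⟨k + 1, fun m hm e => absurd (path_eq_of_le hm e) hk⟩
  choose M hM using hsep
  refine ⟨(Finset.range (i + 1)).sup M, fun m hm => ?_⟩
  have hle : repIdx u (path u (densePoint i) m) ≤ i :=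
    Nat.sInf_le (s := {j | path u (densePoint j) (path u (densePoint i) m).length
      = path u (densePoint i) m}) (by simp)
  have hp := h.dense.path_rep (path u (densePoint i) m)
  rw [length_path] at hp
  exact hM _ m ((Finset.le_sup (f := M) (Finset.mem_range.2 (Nat.lt_succ_of_le hle))).trans hm) hp

/-- Needed to pass from dense points to `α` by right-continuity within one node. At `α = 1` there is
nothing to the right, which is why the sequence contains `1`. -/
lemma DenseKeys.neBot_nhdsWithin_densePoint (h : DenseKeys u) (α : unitInterval) (k : ℕ) :
    (𝓝[{x | (∃ i, densePoint i = x) ∧ path u x k = path u α k ∧ α ≤ x}] α).NeBot := by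
  rw [← mem_closure_iff_nhdsWithin_neBot]
  have hα := inNode_path h α k
  rcases hα.2 with hlt | ⟨rfl, -⟩
  · rw [mem_closure_iff_nhds]
    intro s hs
    obtain ⟨r, hr, hrs⟩ := exists_Ico_subset_of_mem_nhds hs ⟨_, hlt⟩
    obtain ⟨i, h1, h2⟩ := exists_densePoint_between (lt_min hr hlt)
    refine ⟨densePoint i, hrs ⟨h1.le, h2.trans_le (min_le_left _ _)⟩, ⟨i, rfl⟩, ?_, h1.le⟩
    have : InNode u (path u α k) (densePoint i) :=
      ⟨hα.1.trans h1.le, Or.inl (h2.trans_le (min_le_right _ _))⟩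
    simpa using this.path_eq h
  · exact subset_closure ⟨⟨0, rfl⟩, rfl, le_rfl⟩

/-- A right-continuous function whose increments between the representatives of a node and of its
children are controlled by a power of the length of the node has an oscillation on each node that
is controlled by any smaller power. -/
lemma GoodKeys.exists_oscillation_le (h : GoodKeys u) {f : unitInterval → ℝ}
    (hf : ∀ t, ContinuousWithinAt f (Set.Ici t) t) {η η' K : ℝ} (h0 : 0 < η) (hη : η < η')
    (hK : ∀ φ b, |f (rep u (b :: φ)) - f (rep u φ)|
      ≤ K * (φ.length + 1) * len u φ ^ (η' / 2)) :
    ∃ C, ∀ α γ k, path u α k = path u γ k → |f α - f γ| ≤ C * len u (path u α k) ^ (η / 2) := by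
  obtain ⟨C, hC0, hC⟩ := h.exists_tsum_path_le (half_pos h0) (by linarith : η / 2 < η' / 2)
  have hKabs : ∀ φ b, |f (rep u (b :: φ)) - f (rep u φ)|
      ≤ |K| * (((φ.length : ℝ) + 1) * len u φ ^ (η' / 2)) := fun φ b => by
    refine (hK φ b).trans ?_
    rw [mul_assoc]
    exact mul_le_mul_of_nonneg_right (le_abs_self K)
      (mul_nonneg (by positivity) (Real.rpow_nonneg (h.dense.len_pos _).le _))
  have hrep : ∀ i k, |f (densePoint i) - f (rep u (path u (densePoint i) k))|
      ≤ |K| * C * len u (path u (densePoint i) k) ^ (η / 2) := by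
    intro i k
    set α := densePoint i
    obtain ⟨M, hM⟩ := h.exists_rep_path_eq i
    obtain ⟨h1, h2⟩ := hC α k
    -- The chain from the representative of the node reaches the dense point after at most `M`
    -- steps, so no limit is involved.
    have htel : f α - f (rep u (path u α k)) = ∑ j ∈ Finset.range M,
        (f (rep u (path u α (k + (j + 1)))) - f (rep u (path u α (k + j)))) := by
      rw [Finset.sum_range_sub (fun j => f (rep u (path u α (k + j)))), hM (k + M) (by omega),
        add_zero]
    rw [htel]
    calc _ ≤ ∑ j ∈ Finset.range M,
          |f (rep u (path u α (k + (j + 1)))) - f (rep u (path u α (k + j)))| :=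
          Finset.abs_sum_le_sum_abs _ _
      _ ≤ ∑ j ∈ Finset.range M,
          |K| * ((((k + j : ℕ) : ℝ) + 1) * len u (path u α (k + j)) ^ (η' / 2)) := by
          refine Finset.sum_le_sum fun j _ => ?_
          obtain ⟨b, hb⟩ := exists_path_succ u α (k + j)
          rw [← add_assoc, hb]
          have := hKabs (path u α (k + j)) b
          rwa [length_path] at this
      _ ≤ |K| * ∑' j : ℕ, (((k + j : ℕ) : ℝ) + 1) * len u (path u α (k + j)) ^ (η' / 2) := by
          rw [← Finset.mul_sum]
          refine mul_le_mul_of_nonneg_left (h1.sum_le_tsum _ fun j _ => ?_) (abs_nonneg K)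
          exact mul_nonneg (by positivity) (Real.rpow_nonneg (h.dense.len_pos _).le _)
      _ ≤ _ := by
          rw [mul_assoc]
          exact mul_le_mul_of_nonneg_left h2 (abs_nonneg K)
  refine ⟨2 * (|K| * C), fun α γ k hk => ?_⟩
  set Sα := {x | (∃ i, densePoint i = x) ∧ path u x k = path u α k ∧ α ≤ x}
  set Sγ := {x | (∃ i, densePoint i = x) ∧ path u x k = path u γ k ∧ γ ≤ x}
  have hα : (𝓝[Sα] α).NeBot := h.dense.neBot_nhdsWithin_densePoint α k
  have hγ : (𝓝[Sγ] γ).NeBot := h.dense.neBot_nhdsWithin_densePoint γ k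
  have h1 : Tendsto f (𝓝[Sα] α) (𝓝 (f α)) := (hf α).mono fun x hx => hx.2.2
  have h2 : Tendsto f (𝓝[Sγ] γ) (𝓝 (f γ)) := (hf γ).mono fun x hx => hx.2.2
  refine le_of_tendsto ((h1.comp tendsto_fst).sub (h2.comp tendsto_snd)).abs
    (f := fun p : unitInterval × unitInterval => |f p.1 - f p.2|) (x := 𝓝[Sα] α ×ˢ 𝓝[Sγ] γ) ?_
  filter_upwards [prod_mem_prod (self_mem_nhdsWithin (s := Sα)) (self_mem_nhdsWithin (s := Sγ))]
  rintro ⟨x, y⟩ ⟨⟨⟨i, hi⟩, hx, -⟩, ⟨⟨j, hj⟩, hy, -⟩⟩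
  simp only at hi hj hx hy ⊢
  have a1 := hrep i k
  have a2 := hrep j k
  rw [hi, hx] at a1
  rw [hj, hy, ← hk] at a2
  rw [abs_sub_comm] at a2
  calc |f x - f y| = |(f x - f (rep u (path u α k))) + (f (rep u (path u α k)) - f y)| := by
        congr 1; ring
    _ ≤ _ := abs_add_le _ _
    _ ≤ _ := by linarith

/-- The sums along the search paths of terms that are controlled by a power of the length of the
node have an oscillation on each node that is controlled by any smaller power. -/
lemma GoodKeys.exists_tsum_oscillation_le (h : GoodKeys u) {g : Node → ℝ} {η η' K : ℝ}
    (h0 : 0 < η) (hη : η < η') (hK : ∀ φ, |g φ| ≤ K * (φ.length + 1) * len u φ ^ (η' / 2)) :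
    ∃ C, ∀ α γ k, path u α k = path u γ k →
      |∑' j, g (path u α j) - ∑' j, g (path u γ j)| ≤ C * len u (path u α k) ^ (η / 2) := by
  obtain ⟨C, hC0, hC⟩ := h.exists_tsum_path_le (half_pos h0) (by linarith : η / 2 < η' / 2)
  have hsum : ∀ α k, Summable (fun j => g (path u α (k + j))) ∧
      |∑' j, g (path u α (k + j))| ≤ |K| * C * len u (path u α k) ^ (η / 2) := by
    intro α k
    obtain ⟨h1, h2⟩ := hC α k
    have hle : ∀ j, |g (path u α (k + j))|
        ≤ |K| * ((((k + j : ℕ) : ℝ) + 1) * len u (path u α (k + j)) ^ (η' / 2)) := by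
      intro j
      have := hK (path u α (k + j))
      rw [length_path, mul_assoc] at this
      refine this.trans (mul_le_mul_of_nonneg_right (le_abs_self K)
        (mul_nonneg (by positivity) (Real.rpow_nonneg (h.dense.len_pos _).le _)))
    have h3 : Summable fun j => |g (path u α (k + j))| :=
      Summable.of_nonneg_of_le (fun _ => abs_nonneg _) hle (h1.mul_left _)
    refine ⟨h3.of_abs, ?_⟩
    calc |∑' j, g (path u α (k + j))| ≤ ∑' j, |g (path u α (k + j))| := by
          simpa only [Real.norm_eq_abs] using norm_tsum_le_tsum_norm
            (f := fun j => g (path u α (k + j))) (by simpa only [Real.norm_eq_abs] using h3)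
      _ ≤ _ := h3.tsum_le_tsum hle (h1.mul_left _)
      _ ≤ _ := by
          rw [tsum_mul_left, mul_assoc]
          exact mul_le_mul_of_nonneg_left h2 (abs_nonneg K)
  have hsplit : ∀ α k, ∑' j, g (path u α j)
      = ∑ j ∈ Finset.range k, g (path u α j) + ∑' j, g (path u α (k + j)) := by
    intro α k
    have h1 := (hsum α 0).1
    simp only [zero_add] at h1
    rw [← h1.sum_add_tsum_nat_add k]
    simp only [add_comm]
  refine ⟨2 * (|K| * C), fun α γ k hk => ?_⟩
  have e : ∑ j ∈ Finset.range k, g (path u α j) = ∑ j ∈ Finset.range k, g (path u γ j) :=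
    Finset.sum_congr rfl fun j hj => by rw [path_eq_of_le (Finset.mem_range.1 hj).le hk]
  rw [hsplit α k, hsplit γ k, e, add_sub_add_left_eq_sub]
  have a1 := (hsum α k).2
  have a2 := (hsum γ k).2
  rw [← hk] at a2
  refine (abs_sub _ _).trans ?_
  linarith

/-! ### Borel-Cantelli over the nodes of the tree -/

lemma exists_abs_le_mul_of_finite {ι : Type*} {f g : ι → ℝ} (hg : ∀ i, 0 < g i)
    (hfin : {i | g i < |f i|}.Finite) : ∃ K : ℝ, ∀ i, |f i| ≤ K * g i := by
  refine ⟨1 + ∑ j ∈ hfin.toFinset, |f j| / g j, fun i => ?_⟩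
  have hnn : ∀ j ∈ hfin.toFinset, 0 ≤ |f j| / g j := fun j _ =>
    div_nonneg (abs_nonneg _) (hg j).le
  have hS := Finset.sum_nonneg hnn
  rcases le_or_gt (|f i|) (g i) with hi | hi
  · nlinarith [hg i]
  · have h1 : |f i| / g i ≤ ∑ j ∈ hfin.toFinset, |f j| / g j :=
      Finset.single_le_sum hnn (hfin.mem_toFinset.2 hi)
    rw [div_le_iff₀ (hg i)] at h1
    nlinarith [hg i]

lemma tsum_node_length (f : ℕ → ENNReal) : ∑' φ : Node, f φ.length = ∑' n, 2 ^ n * f n := by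
  rw [← (Equiv.sigmaFiberEquiv (List.length : Node → ℕ)).tsum_eq, ENNReal.tsum_sigma']
  refine tsum_congr fun n => ?_
  have : ∀ φ : {l : Node // l.length = n},
      f ((Equiv.sigmaFiberEquiv (List.length : Node → ℕ)) ⟨n, φ⟩).length = f n := fun φ => by
    simp [φ.2]
  simp_rw [this]
  change ∑' _ : List.Vector Bool n, f n = _
  rw [tsum_fintype, Finset.sum_const, Finset.card_univ, card_vector]
  simp

/-- The threshold for the standardized Gaussian increment at a node of depth `n`. -/
noncomputable abbrev threshold (n : ℕ) : ℝ := 2 * ((n : ℝ) + 1)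

/-- The tail at depth `n` is at most `2 exp (-2 (n + 1) ^ 2) ≤ 2 * 4 ^ (-n)`, which beats the `2 ^
n` nodes of that depth. -/
lemma tsum_threshold_ne_top :
    ∑' φ : Node, ENNReal.ofReal (2 * Real.exp (-threshold φ.length ^ 2 / 2)) ≠ ⊤ := by
  rw [tsum_node_length fun n => ENNReal.ofReal (2 * Real.exp (-threshold n ^ 2 / 2))]
  have hs : Summable fun n : ℕ => 2 * ((1 : ℝ) / 2) ^ n := summable_geometric_two.mul_left 2
  refine ne_top_of_le_ne_top hs.tsum_ofReal_ne_top (ENNReal.tsum_le_tsum fun n => ?_)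
  have h2 : (2 : ENNReal) ^ n = ENNReal.ofReal (2 ^ n) := by
    rw [ENNReal.ofReal_pow (by norm_num)]; norm_num
  rw [h2, ← ENNReal.ofReal_mul (by positivity)]
  apply ENNReal.ofReal_le_ofReal
  have h4 : Real.exp (-2) ≤ 1 / 4 := by
    have h1 : Real.exp (-1) ≤ 1 / 2 := by
      rw [Real.exp_neg, one_div]
      exact inv_anti₀ (by norm_num) (by linarith [Real.add_one_le_exp 1])
    calc Real.exp (-2) = Real.exp (-1) * Real.exp (-1) := by rw [← Real.exp_add]; norm_num
      _ ≤ 1 / 2 * (1 / 2) := by gcongr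
      _ = _ := by norm_num
  have h3 : Real.exp (-threshold n ^ 2 / 2) ≤ (1 / 4) ^ n := by
    calc Real.exp (-threshold n ^ 2 / 2) ≤ Real.exp ((n : ℝ) * (-2)) := by
          apply Real.exp_le_exp.2
          have : (0 : ℝ) ≤ n := Nat.cast_nonneg n
          unfold threshold; nlinarith
      _ = Real.exp (-2) ^ n := Real.exp_nat_mul _ _
      _ ≤ _ := by gcongr
  calc (2 : ℝ) ^ n * (2 * Real.exp (-threshold n ^ 2 / 2)) ≤ 2 ^ n * (2 * (1 / 4) ^ n) := by gcongr
    _ = 2 * (2 * (1 / 4)) ^ n := by rw [mul_pow]; ring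
    _ = _ := by norm_num

/-- Bounds proportional to the probability of each value of `q` add up to `t`, so a random choice of
index costs nothing. -/
lemma measure_le_of_partition {Ω ι : Type*} [Countable ι] [MeasurableSpace Ω] {P : Measure Ω}
    [IsProbabilityMeasure P] {q : Ω → ι} (hq : ∀ i, MeasurableSet (q ⁻¹' {i})) {B : ι → Set Ω}
    {t : ENNReal} (h : ∀ i, P (B i ∩ q ⁻¹' {i}) ≤ t * P (q ⁻¹' {i})) :
    P {ω | ω ∈ B (q ω)} ≤ t := by
  have hsub : {ω | ω ∈ B (q ω)} ⊆ ⋃ i, B i ∩ q ⁻¹' {i} := fun ω hω =>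
    Set.mem_iUnion.2 ⟨q ω, hω, rfl⟩
  have hdisj : Pairwise (Function.onFun Disjoint fun i => q ⁻¹' {i}) := fun i j hij =>
    Set.disjoint_left.2 fun ω h1 h2 => hij (h1.symm.trans h2)
  calc P {ω | ω ∈ B (q ω)} ≤ ∑' i, P (B i ∩ q ⁻¹' {i}) :=
        (measure_mono hsub).trans (measure_iUnion_le _)
    _ ≤ ∑' i, t * P (q ⁻¹' {i}) := ENNReal.tsum_le_tsum h
    _ = t * P (⋃ i, q ⁻¹' {i}) := by rw [ENNReal.tsum_mul_left, measure_iUnion hdisj hq]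
    _ ≤ t * 1 := by gcongr; exact prob_le_one
    _ = t := mul_one t

/-! ### The limit processes -/

lemma momentBound_unitCost {θ : ℝ} (h1 : θ ≤ 1) : MomentBound unitCost θ := by
  refine ⟨1, zero_le_one, fun x A _ => ?_⟩
  simp only [ENNReal.coe_one, one_pow, lintegral_one, MeasurableSet.univ, Measure.restrict_apply,
    Set.univ_inter, ENNReal.ofReal_one, one_mul]
  calc volume A = volume A ^ (1 : ℝ) := by simp
    _ ≤ _ := ENNReal.rpow_le_rpow_of_exponent_ge prob_le_one h1

/-! ### Measurability with respect to the interval lengths -/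

section Measurability

variable {X : Type*} [MeasurableSpace X] {κ : X → ℕ → unitInterval}

/-- A left endpoint is the sum of the lengths of the left siblings passed on the way down. Hence the
whole partition, and the choice of representatives, depends measurably on the lengths alone. -/
lemma measurable_left_of_len (h : ∀ φ, Measurable fun x => len (κ x) φ) (φ : Node) :
    Measurable fun x => (left (κ x) φ : ℝ) := by
  induction φ with
  | nil => exact measurable_const
  | cons b φ ih =>
    cases b
    · exact ih
    · have e : (fun x => (left (κ x) (true :: φ) : ℝ))
          = fun x => (left (κ x) φ : ℝ) + len (κ x) (false :: φ) := by
        ext x; simp [len]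
      rw [e]
      exact ih.add (h _)

lemma measurableSet_path_of_len (h : ∀ φ, Measurable fun x => len (κ x) φ) (α : unitInterval)
    (φ : Node) : MeasurableSet {x | path (κ x) α φ.length = φ} := by
  induction φ with
  | nil => simp [path]
  | cons b φ ih =>
    have hp : Measurable fun x => (pivot (κ x) φ : ℝ) := measurable_left_of_len h (true :: φ)
    have hlt : MeasurableSet {x | (α : ℝ) < pivot (κ x) φ} := measurableSet_lt measurable_const hp
    have hle : MeasurableSet {x | (pivot (κ x) φ : ℝ) ≤ α} := measurableSet_le hp measurable_const
    have hstep : ∀ x, path (κ x) α (b :: φ).length = b :: φ ↔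
        path (κ x) α φ.length = φ ∧
          (if b then (pivot (κ x) φ : ℝ) ≤ α else (α : ℝ) < pivot (κ x) φ) := by
      intro x
      rw [List.length_cons, path]
      constructor
      · intro e
        split_ifs at e with hα
        · obtain ⟨e1, e2⟩ := List.cons.inj e
          rw [e2] at hα
          subst e1
          exact ⟨e2, by simpa using hα⟩
        · obtain ⟨e1, e2⟩ := List.cons.inj e
          rw [e2] at hα
          subst e1
          exact ⟨e2, by simpa using hα⟩
      · rintro ⟨e, hb⟩
        rw [e]
        cases b
        · rw [if_pos (by simpa using hb)]
        · rw [if_neg (by simpa using hb)]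
    simp only [hstep]
    cases b
    · simp only [Bool.false_eq_true, if_false]
      exact ih.inter hlt
    · simp only [if_true]
      exact ih.inter hle

lemma measurableSet_repIdx_of_len (h : ∀ φ, Measurable fun x => len (κ x) φ) (φ ψ : Node)
    (i : ℕ × ℕ) : MeasurableSet ((fun x => (repIdx (κ x) φ, repIdx (κ x) ψ)) ⁻¹' {i}) := by
  have hm : ∀ φ, Measurable fun x => repIdx (κ x) φ := fun φ =>
    measurable_sInf_nat fun i => measurableSet_path_of_len h (densePoint i) φ
  exact ((hm φ).prodMk (hm ψ)) (MeasurableSet.singleton i)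

end Measurability

section Random

variable {Ω : Type*} {mΩ : MeasurableSpace Ω} {P : Measure Ω} {U : ℕ → Ω → unitInterval}

lemma measurable_keys (hU : ∀ i, Measurable (U i)) : Measurable (keys U) :=
  measurable_pi_iff.2 hU

lemma Finf_le (hU : ∀ i, Measurable (U i)) : Finf U ≤ mΩ :=
  iSup_le fun φ => ((measurable_len φ).comp (measurable_keys hU)).comap_le

lemma measurable_Finf_len (U : ℕ → Ω → unitInterval) (φ : Node) :
    Measurable[Finf U] fun ω => len (keys U ω) φ := by
  have h : (borel ℝ).comap (fun ω => len (keys U ω) φ) ≤ Finf U :=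
    le_iSup (fun φ : Node => (borel ℝ).comap (fun ω => len (keys U ω) φ)) φ
  rw [← BorelSpace.measurable_eq (α := ℝ)] at h
  exact Measurable.of_comap_le h

lemma map_keys (hU : ∀ i, Measurable (U i)) (hind : iIndepFun U P)
    (hlaw : ∀ i, P.map (U i) = (volume : Measure unitInterval)) : P.map (keys U) = keyLaw := by
  have := hind.map_fun_eq_infinitePi_map hU
  simp_rw [hlaw] at this
  exact this

lemma ae_goodKeys_keys (hU : ∀ i, Measurable (U i)) (hkeys : P.map (keys U) = keyLaw) :
    ∀ᵐ ω ∂P, GoodKeys (keys U ω) :=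
  ae_of_ae_map (measurable_keys hU).aemeasurable (hkeys ▸ ae_goodKeys)

/-- Conditionally Gaussian increments between the representatives of a node and of its children
exceed their standard deviations by a logarithmic factor at finitely many nodes only. -/
lemma ae_finite_large_increments [IsProbabilityMeasure P] (hU : ∀ i, Measurable (U i)) {G : unitInterval → Ω → ℝ}
    {C : Ω → unitInterval → unitInterval → ℝ} (hG : IsMixedCentredGaussian (Finf U) P G C) :
    ∀ᵐ ω ∂P, {φ : Node | threshold φ.length *
        Real.sqrt (C ω (rep (keys U ω) φ) (rep (keys U ω) φ)
          - C ω (rep (keys U ω) φ) (rep (keys U ω) φ.tail)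
          - C ω (rep (keys U ω) φ.tail) (rep (keys U ω) φ)
          + C ω (rep (keys U ω) φ.tail) (rep (keys U ω) φ.tail))
        < |G (rep (keys U ω) φ) ω - G (rep (keys U ω) φ.tail) ω|}.Finite := by
  set B : Node → ℕ × ℕ → Set Ω := fun φ i => {ω | threshold φ.length *
    Real.sqrt (C ω (densePoint i.1) (densePoint i.1) - C ω (densePoint i.1) (densePoint i.2)
      - C ω (densePoint i.2) (densePoint i.1) + C ω (densePoint i.2) (densePoint i.2))
    < |G (densePoint i.1) ω - G (densePoint i.2) ω|} with hB
  -- The representatives of a node and its parent `φ.tail` are random but `F_∞`-measurable; on each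
  -- event where both indices are fixed the increment is between deterministic points.
  set q : Node → Ω → ℕ × ℕ := fun φ ω => (repIdx (keys U ω) φ, repIdx (keys U ω) φ.tail) with hq
  have hqF : ∀ φ i, MeasurableSet[Finf U] (q φ ⁻¹' {i}) := fun φ i =>
    @measurableSet_repIdx_of_len Ω (Finf U) _ (measurable_Finf_len U) φ φ.tail i
  have hmeas : ∀ φ, P {ω | ω ∈ B φ (q φ ω)}
      ≤ ENNReal.ofReal (2 * Real.exp (-threshold φ.length ^ 2 / 2)) := by
    intro φ
    refine measure_le_of_partition (fun i => Finf_le hU _ (hqF φ i)) fun i => ?_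
    rcases eq_or_ne (densePoint i.1) (densePoint i.2) with e | ne
    · have : B φ i = ∅ := by
        ext ω
        simp only [hB, e, Set.mem_ofPred_eq, Set.mem_empty_iff_false, iff_false, not_lt, sub_self,
          abs_zero]
        positivity
      rw [this, Set.empty_inter, measure_empty]
      exact bot_le
    · exact measure_inter_tail_le_of_le (Finf_le hU)
        ((hG.measurable _).sub (hG.measurable _)) (hG.condLaw_sub ne) (by positivity) (hqF φ i)
  exact ae_finite_setOfPred_mem (s := fun φ => {ω | ω ∈ B φ (q φ ω)}) (ne_top_of_le_ne_top tsum_threshold_ne_top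
    (ENNReal.tsum_le_tsum hmeas))

/-- The oscillation of a limit process on the nodes of the tree. -/
lemma ae_exists_oscillation_le [IsProbabilityMeasure P] (hU : ∀ i, Measurable (U i)) (hkeys : P.map (keys U) = keyLaw)
    {β : unitInterval → unitInterval → NNReal} (hβ : Measurable (Function.uncurry β)) {θ : ℝ}
    (hθ : ∀ θ', 0 < θ' → θ' < θ → MomentBound β θ') {G : unitInterval → Ω → ℝ}
    (hG : IsMixedCentredGaussian (Finf U) P G fun ω => covCost β (keys U ω))
    (hcadlag : ∀ᵐ ω ∂P, IsCadlag fun α => G α ω) :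
    ∀ᵐ ω ∂P, ∀ η : ℝ, 0 < η → η < θ → ∃ C, ∀ α γ k,
      path (keys U ω) α k = path (keys U ω) γ k →
      |G α ω - G γ ω| ≤ C * len (keys U ω) (path (keys U ω) α k) ^ (η / 2) := by
  filter_upwards [ae_goodKeys_keys hU hkeys, ae_finite_large_increments hU hG, hcadlag]
    with ω h hfin hc η h0 hη
  set u := keys U ω
  -- With `η < η₁ < η₂ < θ`: `η₂` is the exponent of the moment bound, `η₁` that of the variance of
  -- an increment, and `η` survives the summation of the chain. The almost sure event does not
  -- depend on these choices.
  obtain ⟨η₁, h1, h1'⟩ := exists_between hη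
  obtain ⟨η₂, h2, h2'⟩ := exists_between h1'
  obtain ⟨C, hC0, hC⟩ := h.exists_incVar_le hβ (hθ η₂ (by linarith) h2') (h0.trans h1) h2
  set g : Node → ℝ := fun φ => threshold φ.length * (C * len u φ.tail ^ (η₁ / 2)) with hg
  have hl : ∀ φ : Node, 0 < len u φ ^ (η₁ / 2) := fun φ => Real.rpow_pos_of_pos (h.dense.len_pos _) _
  have hg0 : ∀ φ, 0 < g φ := fun φ => by
    have := hl φ.tail
    positivity
  have hfin' : {φ | g φ < |G (rep u φ) ω - G (rep u φ.tail) ω|}.Finite := by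
    refine hfin.subset fun φ hφ => ?_
    rw [Set.mem_ofPred_eq] at hφ ⊢
    refine lt_of_le_of_lt ?_ hφ
    rw [h.covCost_sub hβ (by linarith) (hθ η₂ (by linarith) h2')]
    -- Both representatives lie in the parent, whose length therefore controls the variance.
    have hpath : path u (rep u φ) φ.tail.length = path u (rep u φ.tail) φ.tail.length := by
      rw [h.dense.path_rep φ.tail]
      rcases φ with _ | ⟨b, φ⟩
      · rfl
      · have := congrArg List.tail (h.dense.path_rep (b :: φ))
        rwa [List.length_cons, tail_path] at this
    have hle := hC _ _ _ hpath
    rw [hpath, h.dense.path_rep φ.tail] at hle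
    have := hl φ.tail
    refine mul_le_mul_of_nonneg_left ?_ (by positivity)
    exact Real.sqrt_le_iff.2 ⟨by positivity, hle⟩
  obtain ⟨K, hK⟩ := exists_abs_le_mul_of_finite hg0 hfin'
  refine h.exists_oscillation_le (fun t => (hc t).1) (K := |K| * 4 * C) h0 h1 fun φ b => ?_
  have h3 := hK (b :: φ)
  simp only [hg, List.tail_cons, List.length_cons] at h3
  refine h3.trans ?_
  have := hl φ
  have hn : (0 : ℝ) ≤ φ.length := Nat.cast_nonneg _
  have ht : threshold (φ.length + 1) ≤ 4 * ((φ.length : ℝ) + 1) := by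
    unfold threshold; push_cast; linarith
  calc K * (threshold (φ.length + 1) * (C * len u φ ^ (η₁ / 2)))
      ≤ |K| * (4 * ((φ.length : ℝ) + 1) * (C * len u φ ^ (η₁ / 2))) := by
        gcongr
        exact le_abs_self K
    _ = _ := by ring

/-- Hölder continuity with respect to both metrics follows from the bound on the oscillation. -/
lemma almostSurelyHolder_of_oscillation (hU : ∀ i, Measurable (U i))
    (hkeys : P.map (keys U) = keyLaw) {G : unitInterval → Ω → ℝ} {θ : ℝ}
    (hG : ∀ᵐ ω ∂P, ∀ η : ℝ, 0 < η → η < θ → ∃ C, ∀ α γ k,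
      path (keys U ω) α k = path (keys U ω) γ k →
      |G α ω - G γ ω| ≤ C * len (keys U ω) (path (keys U ω) α k) ^ (η / 2)) :
    AlmostSurelyHolderBelow P (fun ω => d2 (keys U ω)) (θ * (1 / 4 * Real.logb 2 (3 / 2))) G ∧
    AlmostSurelyHolderBelow P (fun ω => dG (keys U ω)) θ G := by
  have hlog : 0 < 1 / 4 * Real.logb 2 (3 / 2) :=
    mul_pos (by norm_num) (Real.logb_pos (by norm_num) (by norm_num))
  constructor
  · filter_upwards [ae_goodKeys_keys hU hkeys, hG] with ω h hω γ h0 hγ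
    rw [← div_lt_iff₀ hlog] at hγ
    obtain ⟨η, h1, h2⟩ := exists_between hγ
    obtain ⟨C, hC⟩ := hω η ((div_pos h0 hlog).trans h1) h2
    exact h.isHolder_d2 h0 ((div_lt_iff₀ hlog).1 h1) hC
  · filter_upwards [ae_goodKeys_keys hU hkeys, hG] with ω h hω γ h0 hγ
    obtain ⟨C, hC⟩ := hω γ h0 hγ
    exact h.isHolder_dG h0 hC

lemma isMixedCentredGaussian_covCost_unit (hU : ∀ i, Measurable (U i))
    (hkeys : P.map (keys U) = keyLaw) {G : unitInterval → Ω → ℝ}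
    (hG : IsMixedCentredGaussian (Finf U) P G fun ω => covComp (keys U ω)) :
    IsMixedCentredGaussian (Finf U) P G fun ω => covCost unitCost (keys U ω) := by
  refine hG.congr ?_
  filter_upwards [ae_goodKeys_keys hU hkeys] with ω h α γ using h.covComp_eq α γ

/-- The canonical metric is the conditional standard deviation of the increments. -/
lemma condExp_increment_sq [IsProbabilityMeasure P] (hU : ∀ i, Measurable (U i)) (hkeys : P.map (keys U) = keyLaw)
    {G : unitInterval → Ω → ℝ}
    (hG : IsMixedCentredGaussian (Finf U) P G fun ω => covCost unitCost (keys U ω))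
    (α γ : unitInterval) :
    P[fun ω => (G α ω - G γ ω) ^ 2 | Finf U] =ᵐ[P] fun ω => dG (keys U ω) α γ ^ 2 := by
  have hgood := ae_goodKeys_keys hU hkeys
  rcases eq_or_ne α γ with rfl | ne
  · have e : (fun ω => (G α ω - G α ω) ^ 2) = fun _ => (0 : ℝ) := by ext ω; simp
    rw [e, condExp_const (Finf_le hU)]
    filter_upwards [hgood] with ω h
    rw [h.dG_sq, incVar, sub_self, variance_zero]
  · have hv : ∀ᵐ ω ∂P, covCost unitCost (keys U ω) α α - covCost unitCost (keys U ω) α γ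
        - covCost unitCost (keys U ω) γ α + covCost unitCost (keys U ω) γ γ
        = incVar unitCost (keys U ω) α γ := by
      filter_upwards [hgood] with ω h
      exact h.covCost_sub measurable_unitCost one_pos momentBound_one α γ
    obtain ⟨C, hC0, hC⟩ := exists_incVar_le_treeWeight
    refine (condExp_sq_ae_eq_of_le (Finf_le hU) ((hG.measurable α).sub (hG.measurable γ))
      (hG.condLaw_sub ne) ?_ ?_).trans ?_
    · filter_upwards [hv] with ω h
      rw [h]; exact incVar_nonneg _ _ _ _
    -- Integrability of the squared increment: its conditional variance is dominated by a multiple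
    -- of one plus the tree weight.
    · have hW : ∫⁻ ω, treeWeight (keys U ω) ∂P ≠ ⊤ := by
        rw [← lintegral_map measurable_treeWeight (measurable_keys hU), hkeys]
        exact lintegral_treeWeight_ne_top
      have hfin : ∫⁻ ω, ENNReal.ofReal C * (1 + treeWeight (keys U ω)) ∂P ≠ ⊤ := by
        rw [lintegral_const_mul' _ _ ENNReal.ofReal_ne_top, lintegral_add_left measurable_const]
        refine ENNReal.mul_ne_top ENNReal.ofReal_ne_top (ENNReal.add_ne_top.2 ⟨by simp, hW⟩)
      refine ne_top_of_le_ne_top hfin (lintegral_mono_ae ?_)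
      filter_upwards [hv, hgood] with ω h h'
      rw [h]
      refine (ENNReal.ofReal_le_ofReal (hC _ h' α γ)).trans_eq ?_
      rw [ENNReal.ofReal_mul hC0.le, ENNReal.ofReal_add zero_le_one ENNReal.toReal_nonneg,
        ENNReal.ofReal_one, ENNReal.ofReal_toReal h'.decay]
    · filter_upwards [hv, hgood] with ω h h'
      rw [h, h'.dG_sq]

/-! ### The limit process for swaps -/

lemma ae_finite_large_Z [IsProbabilityMeasure P] (hU : ∀ i, Measurable (U i)) {Z Y : Node → Ω → ℝ}
    (h : IsSwapNoise P U Z Y) :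
    ∀ᵐ ω ∂P, {φ : Node | threshold φ.length * Real.sqrt (covZ (keys U ω) φ φ) < |Z φ ω|}.Finite := by
  refine ae_finite_setOfPred_mem
    (s := fun φ => {ω | threshold φ.length * Real.sqrt (covZ (keys U ω) φ φ) < |Z φ ω|})
    (ne_top_of_le_ne_top tsum_threshold_ne_top (ENNReal.tsum_le_tsum fun φ => ?_))
  have := measure_inter_tail_le_of_le (Finf_le hU) (h.gaussian.measurable φ)
    (h.gaussian.condLaw_single φ) (s := threshold φ.length) (by positivity)
    (@MeasurableSet.univ _ (Finf U))
  rwa [Set.inter_univ, measure_univ, mul_one] at this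

lemma ae_finite_large_Y {Z Y : Node → Ω → ℝ} (h : IsSwapNoise P U Z Y) :
    ∀ᵐ ω ∂P, {φ : Node | threshold φ.length < |Y φ ω|}.Finite := by
  refine ae_finite_setOfPred_mem (s := fun φ => {ω | threshold φ.length < |Y φ ω|})
    (ne_top_of_le_ne_top tsum_threshold_ne_top (ENNReal.tsum_le_tsum fun φ => ?_))
  have hm : MeasurableSet {x : ℝ | threshold φ.length < |x|} :=
    measurableSet_lt measurable_const measurable_id.abs
  have h1 := gaussianReal_tail_le 1 (s := threshold φ.length) (by positivity)
  rwa [NNReal.coe_one, Real.sqrt_one, mul_one, ← h.law φ, Measure.map_apply (h.measurable φ) hm]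
    at h1

lemma DenseKeys.covZ_le {u : ℕ → unitInterval} (h : DenseKeys u) (φ : Node) :
    covZ u φ φ ≤ len u φ := by
  have := h.len_pos φ
  rw [covZ, min_self, max_self, ← len, max_eq_left this.le]
  nlinarith

/-- The coefficient of `Y` is at most the square root of the length because a product of two
children lengths is at most the square of the parent's. The coefficients of `Z` are at most `1`. The
`10` is `4 + 4` from the two children, one level deeper, plus `2` from the node itself. -/
lemma DenseKeys.abs_swapTerm_le {Z Y : Node → Ω → ℝ} {ω : Ω} (h : DenseKeys (keys U ω))
    {K₁ K₂ : ℝ} (hK₁ : 0 ≤ K₁) (hK₂ : 0 ≤ K₂)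
    (hZ : ∀ φ, |Z φ ω| ≤ K₁ * (threshold φ.length * Real.sqrt (len (keys U ω) φ)))
    (hY : ∀ φ, |Y φ ω| ≤ K₂ * threshold φ.length) (φ : Node) :
    |swapTerm U Z Y φ ω| ≤ (2 * K₂ + 10 * K₁) * (φ.length + 1)
      * len (keys U ω) φ ^ ((1 : ℝ) / 2) := by
  set u := keys U ω with hu
  have ha := h.len_pos (false :: φ)
  have hb := h.len_pos (true :: φ)
  have hI := h.len_pos φ
  have hab := len_false_add_len_true u φ
  set a := len u (false :: φ) with ha'
  set b := len u (true :: φ) with hb'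
  set I := len u φ with hI'
  have haI : a ≤ I := by linarith
  have hbI : b ≤ I := by linarith
  have habI : a * b ≤ I ^ 2 := by nlinarith
  rw [← Real.sqrt_eq_rpow]
  have hn : (0 : ℝ) ≤ φ.length := Nat.cast_nonneg _
  have ht : threshold (φ.length + 1) ≤ 4 * ((φ.length : ℝ) + 1) := by
    unfold threshold; push_cast; linarith
  have hs0 := Real.sqrt_nonneg I
  have h1 : |Y φ ω * (a * b / I ^ (3 / 2 : ℝ))| ≤ K₂ * threshold φ.length * Real.sqrt I := by
    have e : I ^ (3 / 2 : ℝ) * Real.sqrt I = I ^ 2 := by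
      rw [Real.sqrt_eq_rpow, ← Real.rpow_add hI, ← Real.rpow_natCast]; norm_num
    have hp : 0 < I ^ (3 / 2 : ℝ) := Real.rpow_pos_of_pos hI _
    rw [abs_mul, abs_of_nonneg (by positivity : 0 ≤ a * b / I ^ (3 / 2 : ℝ))]
    refine mul_le_mul (hY φ) ?_ (by positivity) (by positivity)
    rw [div_le_iff₀ hp, mul_comm (Real.sqrt I), e]
    exact habI
  have hchild : ∀ c (x : ℝ), len u (c :: φ) ≤ I → 0 ≤ x → x ≤ 1 →
      |Z (c :: φ) ω * x| ≤ K₁ * (4 * ((φ.length : ℝ) + 1) * Real.sqrt I) := by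
    intro c x hc hx0 hx1
    rw [abs_mul, abs_of_nonneg hx0]
    refine (mul_le_of_le_one_right (abs_nonneg _) hx1).trans ((hZ (c :: φ)).trans ?_)
    rw [List.length_cons]
    gcongr
  have h2 := hchild false (b / I) haI (by positivity) ((div_le_one hI).2 hbI)
  have h3 := hchild true (a / I) hbI (by positivity) ((div_le_one hI).2 haI)
  have h4 : |Z φ ω * (a * b / I ^ 2)| ≤ K₁ * (threshold φ.length * Real.sqrt I) := by
    rw [abs_mul, abs_of_nonneg (by positivity : 0 ≤ a * b / I ^ 2)]
    exact (mul_le_of_le_one_right (abs_nonneg _) ((div_le_one (by positivity)).2 habI)).trans (hZ φ)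
  have e : swapTerm U Z Y φ ω = Y φ ω * (a * b / I ^ (3 / 2 : ℝ)) + Z (false :: φ) ω * (b / I)
      + Z (true :: φ) ω * (a / I) - Z φ ω * (a * b / I ^ 2) := rfl
  rw [e]
  refine (abs_sub _ _).trans ((add_le_add_left ((abs_add_le _ _).trans
    (add_le_add_left (abs_add_le _ _) _)) _).trans ?_)
  refine (add_le_add (add_le_add (add_le_add h1 h2) h3) h4).trans_eq ?_
  unfold threshold
  ring

/-- The paths are explicit series over nodes, so termwise bounds replace both chaining and
right-continuity. -/
lemma ae_exists_oscillation_Gswap_le [IsProbabilityMeasure P] (hU : ∀ i, Measurable (U i))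
    (hkeys : P.map (keys U) = keyLaw) {Z Y : Node → Ω → ℝ} (h : IsSwapNoise P U Z Y) :
    ∀ᵐ ω ∂P, ∀ η : ℝ, 0 < η → η < 1 → ∃ C, ∀ α γ k,
      path (keys U ω) α k = path (keys U ω) γ k →
      |Gswap U Z Y α ω - Gswap U Z Y γ ω|
        ≤ C * len (keys U ω) (path (keys U ω) α k) ^ (η / 2) := by
  filter_upwards [ae_goodKeys_keys hU hkeys, ae_finite_large_Z hU h, ae_finite_large_Y h]
    with ω hω hZ hY η h0 h1
  have hl := fun φ => hω.dense.len_pos φ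
  have hZ' : {φ : Node | threshold φ.length * Real.sqrt (len (keys U ω) φ) < |Z φ ω|}.Finite := by
    refine hZ.subset fun φ hφ => lt_of_le_of_lt ?_
      (show threshold φ.length * Real.sqrt (len (keys U ω) φ) < |Z φ ω| from hφ)
    gcongr
    exact hω.dense.covZ_le φ
  obtain ⟨K₁, hK₁⟩ := exists_abs_le_mul_of_finite (fun φ : Node => by
    have := hl φ; positivity) hZ'
  obtain ⟨K₂, hK₂⟩ := exists_abs_le_mul_of_finite (fun φ : Node => by positivity) hY
  refine hω.exists_tsum_oscillation_le h0 h1 (K := 2 * |K₂| + 10 * |K₁|)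
    (hω.dense.abs_swapTerm_le (abs_nonneg _) (abs_nonneg _) (fun φ => ?_) fun φ => ?_)
  · refine (hK₁ φ).trans ?_
    gcongr
    exact le_abs_self _
  · refine (hK₂ φ).trans ?_
    gcongr
    exact le_abs_self _

end Random

end Quickselect

/-! ### The three limit processes together -/

theorem theorem6 {Ω : Type*} [MeasurableSpace Ω] (P : Measure Ω) [IsProbabilityMeasure P]
    (U : ℕ → Ω → unitInterval) (hUmeas : ∀ i, Measurable (U i)) (hUindep : iIndepFun U P)
    (hUlaw : ∀ i, P.map (U i) = (volume : Measure unitInterval)) :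
    -- the limit process for comparisons, and its canonical metric
    (∀ G : unitInterval → Ω → ℝ,
      Quickselect.IsLimitProcess P U Quickselect.covComp G →
        (∀ α γ : unitInterval,
          P[fun ω => (G α ω - G γ ω) ^ 2 | Quickselect.Finf U] =ᵐ[P]
            fun ω => Quickselect.dG (Quickselect.keys U ω) α γ ^ 2) ∧
        Quickselect.AlmostSurelyHolderBelow P (fun ω => Quickselect.d2 (Quickselect.keys U ω))
          (1 / 4 * Real.logb 2 (3 / 2)) G ∧
        Quickselect.AlmostSurelyHolderBelow P (fun ω => Quickselect.dG (Quickselect.keys U ω))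
          1 G) ∧
    -- the limit process for swaps
    (∀ Z Y : Quickselect.Node → Ω → ℝ,
      Quickselect.IsSwapNoise P U Z Y →
        Quickselect.AlmostSurelyHolderBelow P (fun ω => Quickselect.d2 (Quickselect.keys U ω))
          (1 / 4 * Real.logb 2 (3 / 2)) (Quickselect.Gswap U Z Y) ∧
        Quickselect.AlmostSurelyHolderBelow P (fun ω => Quickselect.dG (Quickselect.keys U ω))
          1 (Quickselect.Gswap U Z Y)) ∧
    -- the limit process for an `ε`-tame cost function
    (∀ (ε : ℝ) (β : unitInterval → unitInterval → NNReal),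
      Measurable (Function.uncurry β) → Quickselect.IsTame ε β → ε < 1 / 4 →
        ∀ G : unitInterval → Ω → ℝ,
          Quickselect.IsLimitProcess P U (Quickselect.covCost β) G →
            Quickselect.AlmostSurelyHolderBelow P
              (fun ω => Quickselect.d2 (Quickselect.keys U ω))
              ((1 - 2 * ε) * (1 / 4 * Real.logb 2 (3 / 2))) G ∧
            Quickselect.AlmostSurelyHolderBelow P
              (fun ω => Quickselect.dG (Quickselect.keys U ω))
              (1 - 2 * ε) G) := by
  have hkeys := Quickselect.map_keys hUmeas hUindep hUlaw
  refine ⟨fun G hG => ?_, fun Z Y h => ?_, fun ε β hβ htame hε G hG => ?_⟩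
  · have hG' := Quickselect.isMixedCentredGaussian_covCost_unit hUmeas hkeys hG.gaussian
    have h := Quickselect.almostSurelyHolder_of_oscillation hUmeas hkeys
      (Quickselect.ae_exists_oscillation_le hUmeas hkeys Quickselect.measurable_unitCost
        (fun θ _ h1 => Quickselect.momentBound_unitCost h1.le) hG' hG.cadlag)
    rw [one_mul] at h
    exact ⟨Quickselect.condExp_increment_sq hUmeas hkeys hG', h⟩
  · have h := Quickselect.almostSurelyHolder_of_oscillation hUmeas hkeys
      (Quickselect.ae_exists_oscillation_Gswap_le hUmeas hkeys h)
    rwa [one_mul] at h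
  · exact Quickselect.almostSurelyHolder_of_oscillation hUmeas hkeys
      (Quickselect.ae_exists_oscillation_le hUmeas hkeys hβ
        (fun θ h0 h1 => htame.momentBound hβ h0.le h1) hG.gaussian hG.cadlag)
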